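/- Let $\mu$ be the surface measure on the unit sphere $\mathbb S^2\subset\mathbb R^3$, $P_\ell$ the Legendre polynomials ($P_\ell(1)=1$), $Y_{\ell,k}$ ($\ell\ge 0$, $1\le k\le 2\ell+1$) the standard real orthonormal spherical harmonics, $\lambda_\ell=\ell(\ell+1)$, and for $\ell\ge1$ $$\mathbf y_{\ell,k}=\lambda_\ell^{-1/2}\,\mathbf L_*Y_{\ell,k},\qquad \mathbf z_{\ell,k}=\lambda_\ell^{-1/2}\,\nabla_*Y_{\ell,k},$$ where at $x\in\mathbb S^2$ one has $\nabla_*=(\mathbf I-xx^\top)\nabla$ and $\mathbf L_*=x\times\nabla$. For real $s\ge 0$, $\mathbf H^s(\mathbb S^2)$ is the space of square-integrable tangential fields $\mathbf f:\mathbb S^2\to\mathbb R^3$ with $$\|\mathbf f\|_{\mathbf H^s}^2=\sum_{\ell=1}^\infty\sum_{k=1}^{2\ell+1}(1+\lambda_\ell)^s\big(|\langle \mathbf f,\mathbf y_{\ell,k}\rangle|^2+|\langle \mathbf f,\mathbf z_{\ell,k}\rangle|^2\big)<\infty .$$ Let $(\psi_\rho)_{0<\rho<1}$ be a family of zonal kernels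 such that $(\rho,t)\mapsto\psi_\rho(t)$ is continuous on $(0,1)\times[-1,1]$ and $\widehat\psi_\rho(0)=1$, where $\widehat\psi_\rho(\ell)=2\pi\int_{-1}^1\psi_\rho(t)P_\ell(t)\,dt$. (This includes the scaled radial kernels $\psi_\rho(x\cdot y)=C_\rho\,\phi(\rho^{-1}\|x-y\|)$ with $\phi\in C[0,\infty)$ and $C_\rho$ the constant with $\int_{\mathbb S^2}\psi_\rho(x\cdot y)\,d\mu(x)=1$.) Put $\ell_\rho=\lfloor\rho^{-1}-1\rfloor$ and suppose that for some $m\ge0$, $0<\rho_0<1$ and $c_1,c_2>0$ $$|1-\widehat\psi_\rho(\ell)|\le c_1(\ell\rho)^m\quad(0<\rho<\rho_0,\ 0\le\ell\le\ell_\rho),\qquad |\widehat\psi_\rho(\ell)|\le c_2\quad(0<\rho<1,\ \ell>\ell_\rho).$$ With $t=x\cdot y$, let $$\kappa_\rho(t)=\frac1{4\pi(1-t^2)}\int_{-1}^t\big(1-4\pi\psi_\rho(s)\big)\,ds$$ on $(-1,1)$, extended to $\pm1$ by its limits, and let $\Psi_\rho=\Psi_\rho^{\mathrm{div}}+\Psi_\rho^{\mathrm{curl}}$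 with $$\Psi_\rho^{\mathrm{div}}(x,y)=-\kappa_\rho'(t)(x\times y)(x\times y)^\top+\kappa_\rho(t)(t\mathbf I-yx^\top),$$ $$\Psi_\rho^{\mathrm{curl}}(x,y)=\kappa_\rho'(t)(y-tx)(x-ty)^\top+\kappa_\rho(t)(\mathbf I-xx^\top)(\mathbf I-yy^\top),$$ the terms with $\kappa_\rho'$ being $0$ for $x=\pm y$. Let $(\mathcal C_{\Psi_\rho}\mathbf f)(x)=\int_{\mathbb S^2}\Psi_\rho(x,y)\mathbf f(y)\,d\mu(y)$. Let $0\le\tau\le\sigma\le m$ be real. Then there is a constant $C>0$, independent of $\rho$ and $\mathbf f$, such that for all $0<\rho<1$ and all $\mathbf f\in\mathbf H^\sigma(\mathbb S^2)$ the integral that defines $(\mathcal C_{\Psi_\rho}\mathbf f)(x)$ converges absolutely for every $x\in\mathbb S^2$, $\mathbf f-\mathcal C_{\Psi_\rho}\mathbf f\in\mathbf H^\tau(\mathbb S^2)$, and $$\|\mathbf f-\mathcal C_{\Psi_\rho}\mathbf f\|_{\mathbf H^\tau(\mathbb S^2)}\le C\,\rho^{\sigma-\tau}\,\|\mathbf f\|_{\mathbf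 H^\sigma(\mathbb S^2)} .$$ -/

import Mathlib

open MeasureTheory Polynomial
open scoped ENNReal Nat Matrix

noncomputable section

namespace TangentSphere

/-- Euclidean three-space. -/
abbrev E3 : Type := EuclideanSpace ℝ (Fin 3)

/-- The unit sphere `𝕊²` in `ℝ³`. -/
abbrev S2 : Type := Metric.sphere (0 : E3) 1

/-- The rotation invariant surface measure on `𝕊²` (of total mass `4π`). -/
def surf : Measure S2 := (volume : Measure E3).toSphere

/-- The cross product in `ℝ³`. -/
def cross (x y : E3) : E3 := WithLp.toLp 2 (crossProduct x.ofLp y.ofLp)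

/-! ### Spherical harmonics -/

/-- The Legendre polynomial `P_ℓ`, by Rodrigues' formula (so that `P_ℓ(1) = 1`). -/
def legendreP (l : ℕ) : ℝ[X] :=
  C (1 / (2 ^ l * (l ! : ℝ))) * derivative^[l] ((X ^ 2 - 1) ^ l)

/-- The order `q ∈ {-ℓ, …, ℓ}` that belongs to the index `k ∈ {0, …, 2ℓ}`. -/
def orderOfIndex (l : ℕ) (k : Fin (2 * l + 1)) : ℤ := ((k : ℕ) : ℤ) - (l : ℤ)

/-- The normalising constant of the real spherical harmonic of degree `ℓ` and order `q`. -/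
def harmonicNorm (l : ℕ) (q : ℤ) : ℝ :=
  if q = 0 then √((2 * l + 1) / (4 * Real.pi))
  else √((2 * l + 1) / (2 * Real.pi) * ((l - q.natAbs)! : ℝ) / ((l + q.natAbs)! : ℝ))

/-- The standard real orthonormal spherical harmonic `Y_{ℓ,k}`, as a polynomial function on `ℝ³`.
With `m = |q|` and with `x = (sin θ cos φ, sin θ sin φ, cos θ)` on the sphere, it equals
`N · (sin θ)^m P_ℓ^{(m)}(cos θ) cos (m φ)` for `q ≥ 0` and the same with `sin (m φ)` for `q < 0`. -/
def Y (l : ℕ) (k : Fin (2 * l + 1)) (x : E3) : ℝ :=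
  harmonicNorm l (orderOfIndex l k) *
    (derivative^[(orderOfIndex l k).natAbs] (legendreP l)).eval (x 2) *
    (if 0 ≤ orderOfIndex l k
      then (((⟨x 0, x 1⟩ : ℂ) ^ (orderOfIndex l k).natAbs).re)
      else (((⟨x 0, x 1⟩ : ℂ) ^ (orderOfIndex l k).natAbs).im))

/-- The eigenvalue `λ_ℓ = ℓ (ℓ + 1)` of minus the Laplace–Beltrami operator. -/
def eigenval (l : ℕ) : ℝ := (l : ℝ) * ((l : ℝ) + 1)

/-- The surface gradient `∇_* F = (I - x xᵀ) ∇F` on `𝕊²`, for `F` given near the sphere. -/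
def surfGrad (F : E3 → ℝ) (x : S2) : E3 :=
  gradient F (x : E3) - (inner ℝ (x : E3) (gradient F (x : E3))) • (x : E3)

/-- The surface curl `L_* F = x × ∇F` on `𝕊²`, for `F` given near the sphere. -/
def surfCurl (F : E3 → ℝ) (x : S2) : E3 := cross (x : E3) (gradient F (x : E3))

/-- The divergence-free vector spherical harmonics `y_{ℓ,k}` (for `ℓ ≥ 1`). -/
def vecY (l : ℕ) (k : Fin (2 * l + 1)) (x : S2) : E3 :=
  (√(eigenval l))⁻¹ • surfCurl (Y l k) x

/-- The curl-free vector spherical harmonics `z_{ℓ,k}` (for `ℓ ≥ 1`). -/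
def vecZ (l : ℕ) (k : Fin (2 * l + 1)) (x : S2) : E3 :=
  (√(eigenval l))⁻¹ • surfGrad (Y l k) x

/-! ### Sobolev spaces of tangential fields -/

/-- `f` is a square-integrable tangential vector field on `𝕊²`. -/
def IsTangentL2 (f : S2 → E3) : Prop :=
  (∀ x : S2, inner ℝ (x : E3) (f x) = 0) ∧ MemLp f 2 surf

/-- The divergence-free Fourier–Legendre coefficients `⟨f, y_{ℓ,k}⟩`. -/
def coeffDiv (f : S2 → E3) (l : ℕ) (k : Fin (2 * l + 1)) : ℝ :=
  ∫ x, inner ℝ (f x) (vecY l k x) ∂surf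

/-- The curl-free Fourier–Legendre coefficients `⟨f, z_{ℓ,k}⟩`. -/
def coeffCurl (f : S2 → E3) (l : ℕ) (k : Fin (2 * l + 1)) : ℝ :=
  ∫ x, inner ℝ (f x) (vecZ l k x) ∂surf

/-- The term of degree `ℓ` of the squared Sobolev norm of order `s`. -/
def sobolevTerm (s : ℝ) (f : S2 → E3) (l : ℕ) : ℝ :=
  ∑ k : Fin (2 * l + 1), (1 + eigenval l) ^ s * (|coeffDiv f l k| ^ 2 + |coeffCurl f l k| ^ 2)

/-- The Sobolev norm of order `s` of a square-integrable tangential field, with value `∞` if the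
series over the degrees `ℓ = 1, 2, …` diverges. -/
def sobolevNorm (s : ℝ) (f : S2 → E3) : ℝ≥0∞ :=
  (∑' n : ℕ, ENNReal.ofReal (sobolevTerm s f (n + 1))) ^ (1 / 2 : ℝ)

/-- Membership in the Sobolev space of order `s` of tangential fields on `𝕊²`. -/
def MemSobolev (s : ℝ) (f : S2 → E3) : Prop :=
  IsTangentL2 f ∧ sobolevNorm s f < ∞

/-! ### Zonal kernels and the convolution operator -/

/-- The Fourier–Legendre coefficient `2π ∫_{-1}^1 ψ(t) P_ℓ(t) dt` of a zonal kernel, that is, the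
coefficient in `ψ = ∑ (2ℓ+1)/(4π) ψ̂(ℓ) P_ℓ`. -/
def zonalCoeff (ψ : ℝ → ℝ) (l : ℕ) : ℝ :=
  2 * Real.pi * ∫ t in (-1 : ℝ)..1, ψ t * (legendreP l).eval t

/-- The auxiliary function `κ` of a zonal kernel `ψ` with `ψ̂(0) = 1`. The values at `±1` are the
limits of the formula that defines `κ` on `(-1,1)`. -/
def kappa (ψ : ℝ → ℝ) (t : ℝ) : ℝ :=
  if t = 1 then (4 * Real.pi * ψ 1 - 1) / (8 * Real.pi)
  else if t = -1 then (1 - 4 * Real.pi * ψ (-1)) / (8 * Real.pi)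
  else (∫ s in (-1 : ℝ)..t, (1 - 4 * Real.pi * ψ s)) / (4 * Real.pi * (1 - t ^ 2))

/-- `Q(x,y) = -(x × y)(x × y)ᵀ` -/
def matQ (x y : E3) : Matrix (Fin 3) (Fin 3) ℝ :=
  -Matrix.vecMulVec (cross x y).ofLp (cross x y).ofLp

/-- `R(x,y) = (x · y) I - y xᵀ` -/
def matR (x y : E3) : Matrix (Fin 3) (Fin 3) ℝ :=
  (inner ℝ x y) • (1 : Matrix (Fin 3) (Fin 3) ℝ) - Matrix.vecMulVec y.ofLp x.ofLp

/-- `V(x,y) = (y - t x)(x - t y)ᵀ` with `t = x · y` -/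
def matV (x y : E3) : Matrix (Fin 3) (Fin 3) ℝ :=
  Matrix.vecMulVec (y - (inner ℝ x y) • x).ofLp (x - (inner ℝ x y) • y).ofLp

/-- `W(x,y) = (I - x xᵀ)(I - y yᵀ)` -/
def matW (x y : E3) : Matrix (Fin 3) (Fin 3) ℝ :=
  (1 - Matrix.vecMulVec x.ofLp x.ofLp) * (1 - Matrix.vecMulVec y.ofLp y.ofLp)

/-- The divergence-free kernel `κ'(t) Q + κ(t) R`, `t = x · y`. For `x = ±y` one has `Q = 0`, so
there the value of `deriv` at `t = ±1` does not matter. -/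
def kerDiv (ψ : ℝ → ℝ) (x y : S2) : Matrix (Fin 3) (Fin 3) ℝ :=
  deriv (kappa ψ) (inner ℝ (x : E3) (y : E3)) • matQ x y +
    kappa ψ (inner ℝ (x : E3) (y : E3)) • matR x y

/-- The curl-free kernel `κ'(t) V + κ(t) W`, `t = x · y`. For `x = ±y` one has `V = 0`. -/
def kerCurl (ψ : ℝ → ℝ) (x y : S2) : Matrix (Fin 3) (Fin 3) ℝ :=
  deriv (kappa ψ) (inner ℝ (x : E3) (y : E3)) • matV x y +
    kappa ψ (inner ℝ (x : E3) (y : E3)) • matW x y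

/-- The combined matrix kernel `Ψ = Ψ^div + Ψ^curl`. -/
def ker (ψ : ℝ → ℝ) (x y : S2) : Matrix (Fin 3) (Fin 3) ℝ := kerDiv ψ x y + kerCurl ψ x y

/-- The integrand `y ↦ Ψ(x,y) f(y)` of the convolution operator. -/
def convIntegrand (ψ : ℝ → ℝ) (f : S2 → E3) (x y : S2) : E3 :=
  WithLp.toLp 2 (ker ψ x y *ᵥ (f y).ofLp)

/-- The convolution operator `(C_Ψ f)(x) = ∫ Ψ(x,y) f(y) dμ(y)`. -/
def conv (ψ : ℝ → ℝ) (f : S2 → E3) (x : S2) : E3 := ∫ y, convIntegrand ψ f x y ∂surf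

/-- A family of normalised zonal kernels `ψ_ρ : [-1,1] → ℝ`, `0 < ρ < 1`, that depends continuously
on the scaling parameter and on the argument. (Values for other `ρ`, `t` are irrelevant.) -/
structure IsZonalFamily (ψ : ℝ → ℝ → ℝ) : Prop where
  continuousOn : ContinuousOn (Function.uncurry ψ) (Set.Ioo (0 : ℝ) 1 ×ˢ Set.Icc (-1 : ℝ) 1)
  normalised : ∀ ρ ∈ Set.Ioo (0 : ℝ) 1, zonalCoeff (ψ ρ) 0 = 1

/-- The approximation condition of order `m` on the Fourier–Legendre coefficients of a family of
zonal kernels, with the cut-off degree `ℓ_ρ = ⌊ρ⁻¹ - 1⌋`. -/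
def ApproxOrder (ψ : ℝ → ℝ → ℝ) (m : ℝ) : Prop :=
  0 ≤ m ∧ ∃ ρ₀ c₁ c₂ : ℝ, 0 < ρ₀ ∧ ρ₀ < 1 ∧ 0 < c₁ ∧ 0 < c₂ ∧
    (∀ ρ : ℝ, 0 < ρ → ρ < ρ₀ → ∀ l : ℕ, l ≤ ⌊ρ⁻¹ - 1⌋₊ →
      |1 - zonalCoeff (ψ ρ) l| ≤ c₁ * ((l : ℝ) * ρ) ^ m) ∧
    (∀ ρ : ℝ, 0 < ρ → ρ < 1 → ∀ l : ℕ, ⌊ρ⁻¹ - 1⌋₊ < l → |zonalCoeff (ψ ρ) l| ≤ c₂)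

end TangentSphere

end

noncomputable section

namespace TangentSphere

/-! ### Legendre polynomials -/

/-! The operator `conv` is a Fourier multiplier: each coefficient of degree `l ≥ 1` of `f - conv ψ
f` is `1 - ψ̂(l)` times that of `f`. The hypotheses bound this factor by `C (ρ √(1 + λ_l)) ^ (σ -
τ)` (`exists_multiplier_bound`). Squaring and multiplying by the weight `(1 + λ_l) ^ τ` gives `C² ρ
^ (2 (σ - τ)) (1 + λ_l) ^ σ`, and summation over `l` gives the estimate. The norms are defined
through the coefficients, so neither orthonormality nor completeness of the harmonics enters; only
their eigenvalue equation does.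

The multiplier property is a vector Funk–Hecke formula, obtained in three stages.

Scalar stage (`sphereFunctional_eq`): for an eigenfunction `F` of the spherical Laplacian, `p ↦ ∫
p(x·y) F(x) dμ(x)` and `p ↦ p̂(l)` are both eigenvectors of the transposed Legendre operator on
polynomials. Such functionals form a space of dimension at most one. The factor `F(y)` between the
two is found by testing with the powers `(1 + t) ^ n`, which concentrate at `x = y`.

Vector stage (`integral_kerForm`): if `ψ = 1/(4π) - ((1 - t²) h')'`, then `κ = h'` is a polynomial.
The form `Z(x) · Ψ(x,y) v` is a sum of two derivatives in `y` of scalar zonal integrands. For `Z =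
∇_* F` or `Z = L_* F` one of the two scalar integrals is zero, and the other is `ψ̂(l) F(y)` by
integration by parts and the scalar formula.

Limit stage (`IsConvEigenfield.integral_ker`): every normalised polynomial has the above form
(`exists_kernelPoly`), and `Ψ` is Lipschitz in `ψ` for the uniform norm (`norm_ker_sub_le`), because
the singular factor `κ'` always comes with a weight `1 - t²`. Weierstrass approximation then covers
continuous `ψ`. -/

lemma iterate_derivative_sq_sub_one_pow (l k : ℕ) :
    (X ^ 2 - 1 : ℝ[X]) * derivative^[k + 2] ((X ^ 2 - 1) ^ l)
      + 2 * ((k : ℝ[X]) + 1 - (l : ℝ[X])) * X * derivative^[k + 1] ((X ^ 2 - 1) ^ l)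
      + ((k : ℝ[X]) + 1) * ((k : ℝ[X]) - 2 * (l : ℝ[X])) *
        derivative^[k] ((X ^ 2 - 1) ^ l) = 0 := by
  induction k with
  | zero =>
    -- The first-order equation of `(X² - 1) ^ l`. Differentiating it once gives the case `k = 0`,
    -- and each further differentiation raises `k` by one.
    have h : (X ^ 2 - 1 : ℝ[X]) * derivative ((X ^ 2 - 1) ^ l) =
        2 * (l : ℝ[X]) * X * (X ^ 2 - 1) ^ l := by
      cases l with
      | zero => simp
      | succ n =>
        rw [derivative_pow]
        simp only [Nat.add_sub_cancel, derivative_sub, derivative_X_pow, derivative_one,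
          map_natCast]
        simp
        ring
    have h' := congrArg derivative h
    simp only [derivative_mul, derivative_sub, derivative_X_pow, derivative_one, derivative_X,
      derivative_natCast, derivative_ofNat] at h'
    simp only [Function.iterate_succ, Function.iterate_zero, Function.comp, id]
    simp [show (C 2 : ℝ[X]) = 2 from map_ofNat C 2] at h' ⊢
    linear_combination h'
  | succ k ih =>
    have h' := congrArg derivative ih
    simp only [derivative_mul, derivative_add, derivative_sub, derivative_X_pow, derivative_one,
      derivative_X, derivative_natCast, derivative_ofNat, derivative_zero,
      ← Function.iterate_succ_apply'] at h'
    simp [show (C 2 : ℝ[X]) = 2 from map_ofNat C 2] at h' ⊢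
    linear_combination h'

/-- The differential equation of the derivatives of Legendre polynomials. -/
lemma iterate_derivative_legendreP (l m : ℕ) :
    (X ^ 2 - 1 : ℝ[X]) * derivative^[m + 2] (legendreP l)
      + 2 * ((m : ℝ[X]) + 1) * X * derivative^[m + 1] (legendreP l)
      + ((l : ℝ[X]) + (m : ℝ[X]) + 1) * ((m : ℝ[X]) - (l : ℝ[X])) *
        derivative^[m] (legendreP l) = 0 := by
  have h := iterate_derivative_sq_sub_one_pow l (m + l)
  simp only [legendreP, iterate_derivative_C_mul, ← Function.iterate_add_apply]
  rw [show m + 2 + l = m + l + 2 by ring, show m + 1 + l = m + l + 1 by ring]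
  push_cast at h
  linear_combination (C (1 / (2 ^ l * (l ! : ℝ)))) * h

lemma eval_one_legendreP (l : ℕ) : (legendreP l).eval 1 = 1 := by
  -- In Leibniz' rule only the term with all `l` derivatives on `(X - 1) ^ l` survives at `1`.
  have h : ∀ p : ℝ[X], (derivative^[l] ((X - C 1) ^ l * p)).eval 1 = l ! * p.eval 1 := by
    intro p
    rw [iterate_derivative_mul, eval_finsetSum, Finset.sum_eq_single 0]
    · simp only [Nat.sub_zero, iterate_derivative_X_sub_pow_self]
      simp
    · intro k hk hk0
      simp only [Finset.mem_range] at hk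
      rw [iterate_derivative_X_sub_pow]
      have : l - (l - k) ≠ 0 := by omega
      simp [this]
    · simp
  have h2 : ((X : ℝ[X]) ^ 2 - 1) ^ l = (X - C 1) ^ l * (X + 1) ^ l := by
    rw [← mul_pow]; congr 1; simp; ring
  rw [legendreP, h2, eval_mul, h]
  have : (l ! : ℝ) ≠ 0 := by exact_mod_cast l.factorial_ne_zero
  simp
  norm_num
  field_simp

/-! ### Angular derivatives of polynomials -/

/-- The component `X_{i+1} ∂_{i+2} - X_{i+2} ∂_{i+1}` of the operator `x × ∇`. -/
def angDeriv (i : Fin 3) :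
    Derivation ℝ (MvPolynomial (Fin 3) ℝ) (MvPolynomial (Fin 3) ℝ) :=
  (MvPolynomial.X (i + 1) : MvPolynomial (Fin 3) ℝ) • MvPolynomial.pderiv (i + 2) -
    (MvPolynomial.X (i + 2) : MvPolynomial (Fin 3) ℝ) • MvPolynomial.pderiv (i + 1)

lemma angDeriv_apply (i : Fin 3) (F : MvPolynomial (Fin 3) ℝ) :
    angDeriv i F = MvPolynomial.X (i + 1) * MvPolynomial.pderiv (i + 2) F -
      MvPolynomial.X (i + 2) * MvPolynomial.pderiv (i + 1) F := rfl

/-- The square `∑ L_i L_i` of the operator `L = x × ∇`. -/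
def angLap (F : MvPolynomial (Fin 3) ℝ) : MvPolynomial (Fin 3) ℝ :=
  ∑ i, angDeriv i (angDeriv i F)

/-- The pairing `LF · LG` for `L = x × ∇`. -/
def angPair (F G : MvPolynomial (Fin 3) ℝ) : MvPolynomial (Fin 3) ℝ :=
  ∑ i, angDeriv i F * angDeriv i G

lemma angDeriv_mul (i : Fin 3) (F G : MvPolynomial (Fin 3) ℝ) :
    angDeriv i (F * G) = angDeriv i F * G + F * angDeriv i G := by
  rw [Derivation.leibniz]; simp; ring

lemma angLap_mul (F G : MvPolynomial (Fin 3) ℝ) :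
    angLap (F * G) = angLap F * G + 2 * angPair F G + F * angLap G := by
  simp only [angLap, angPair, angDeriv_mul, map_add, Fin.sum_univ_three]
  ring

lemma angLap_sub (F G : MvPolynomial (Fin 3) ℝ) : angLap (F - G) = angLap F - angLap G := by
  simp [angLap]

lemma angLap_add (F G : MvPolynomial (Fin 3) ℝ) : angLap (F + G) = angLap F + angLap G := by
  simp [angLap, Finset.sum_add_distrib]

lemma angLap_C_mul (a : ℝ) (F : MvPolynomial (Fin 3) ℝ) :
    angLap (MvPolynomial.C a * F) = MvPolynomial.C a * angLap F := by
  have h : ∀ i, angDeriv i (MvPolynomial.C a) = 0 := fun i => (angDeriv i).map_algebraMap a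
  simp [angLap, h, Finset.mul_sum]

lemma angPair_sub (F G H : MvPolynomial (Fin 3) ℝ) :
    angPair F (G - H) = angPair F G - angPair F H := by
  simp [angPair, mul_sub]

lemma angPair_add (F G H : MvPolynomial (Fin 3) ℝ) :
    angPair F (G + H) = angPair F G + angPair F H := by
  simp [angPair, mul_add, Finset.sum_add_distrib]

lemma angPair_mul (F G H : MvPolynomial (Fin 3) ℝ) :
    angPair F (G * H) = angPair F G * H + G * angPair F H := by
  simp only [angPair, angDeriv_mul, Fin.sum_univ_three]
  ring

lemma angPair_X (i j : Fin 3) : angPair (MvPolynomial.X i) (MvPolynomial.X j) =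
    (if i = j then ∑ k, MvPolynomial.X k ^ 2 else 0) - MvPolynomial.X i * MvPolynomial.X j := by
  fin_cases i <;> fin_cases j <;>
    simp [angPair, angDeriv_apply, Fin.sum_univ_three, MvPolynomial.pderiv_X, Pi.single_apply,
      show (1 : Fin 3) + 2 = 0 from rfl, show (2 : Fin 3) + 1 = 0 from rfl,
      show (1 : Fin 3) + 1 = 2 from rfl, show (2 : Fin 3) + 2 = 1 from rfl] <;> ring

lemma angLap_X (i : Fin 3) : angLap (MvPolynomial.X i) = -2 * MvPolynomial.X i := by
  fin_cases i <;>
    simp [angLap, angDeriv_apply, Fin.sum_univ_three, MvPolynomial.pderiv_X, Pi.single_apply,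
      show (1 : Fin 3) + 2 = 0 from rfl, show (2 : Fin 3) + 1 = 0 from rfl,
      show (1 : Fin 3) + 1 = 2 from rfl, show (2 : Fin 3) + 2 = 1 from rfl] <;> ring

lemma angDeriv_aeval (i : Fin 3) (q : ℝ[X]) (F : MvPolynomial (Fin 3) ℝ) :
    angDeriv i (aeval F q) = aeval F (derivative q) * angDeriv i F := by
  induction q using Polynomial.induction_on' with
  | add p q hp hq => simp [hp, hq, add_mul]
  | monomial n a =>
    simp only [aeval_monomial, derivative_monomial, Derivation.leibniz, Derivation.leibniz_pow,
      MvPolynomial.algebraMap_eq]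
    have : angDeriv i (MvPolynomial.C a) = 0 := (angDeriv i).map_algebraMap a
    simp [this]
    ring

lemma angPair_aeval (q : ℝ[X]) (F G : MvPolynomial (Fin 3) ℝ) :
    angPair (aeval F q) G = aeval F (derivative q) * angPair F G := by
  simp only [angPair, angDeriv_aeval, Fin.sum_univ_three]
  ring

lemma angLap_aeval (q : ℝ[X]) (F : MvPolynomial (Fin 3) ℝ) :
    angLap (aeval F q) = aeval F (derivative (derivative q)) * angPair F F
      + aeval F (derivative q) * angLap F := by
  simp only [angLap, angPair, angDeriv_aeval, angDeriv_mul, Fin.sum_univ_three]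
  ring

/-- Real and imaginary part of `(X₀ + i X₁) ^ n`. -/
def azimuth : ℕ → MvPolynomial (Fin 3) ℝ × MvPolynomial (Fin 3) ℝ
  | 0 => (1, 0)
  | n + 1 => (MvPolynomial.X 0 * (azimuth n).1 - MvPolynomial.X 1 * (azimuth n).2,
      MvPolynomial.X 0 * (azimuth n).2 + MvPolynomial.X 1 * (azimuth n).1)

/-- With `ζ = X₀ + i X₁` these are the real and imaginary parts of `Lζ · L(ζ ^ n) = -n ζ ^ (n + 1)`.
This follows from `Lζ · Lζ = -ζ²`, where the `|x|²` terms cancel because `ζ` is isotropic. -/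
lemma angPair_X_azimuth (n : ℕ) :
    angPair (MvPolynomial.X 0) (azimuth n).1 - angPair (MvPolynomial.X 1) (azimuth n).2 =
        -(n : MvPolynomial (Fin 3) ℝ) * (azimuth (n + 1)).1 ∧
      angPair (MvPolynomial.X 0) (azimuth n).2 + angPair (MvPolynomial.X 1) (azimuth n).1 =
        -(n : MvPolynomial (Fin 3) ℝ) * (azimuth (n + 1)).2 := by
  induction n with
  | zero => simp [azimuth, angPair]
  | succ n ih =>
    obtain ⟨h1, h2⟩ := ih
    simp only [azimuth, angPair_sub, angPair_add, angPair_mul, angPair_X] at h1 h2 ⊢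
    simp [Fin.sum_univ_three]
    constructor
    · linear_combination (MvPolynomial.X 0) * h1 - (MvPolynomial.X 1) * h2
    · linear_combination (MvPolynomial.X 0) * h2 + (MvPolynomial.X 1) * h1

lemma angPair_X_two_azimuth (n : ℕ) :
    angPair (MvPolynomial.X 2) (azimuth n).1 =
        -(n : MvPolynomial (Fin 3) ℝ) * MvPolynomial.X 2 * (azimuth n).1 ∧
      angPair (MvPolynomial.X 2) (azimuth n).2 =
        -(n : MvPolynomial (Fin 3) ℝ) * MvPolynomial.X 2 * (azimuth n).2 := by
  induction n with
  | zero => simp [azimuth, angPair]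
  | succ n ih =>
    obtain ⟨h1, h2⟩ := ih
    simp only [azimuth, angPair_sub, angPair_add, angPair_mul, angPair_X, h1, h2]
    simp
    constructor <;> ring

lemma angLap_azimuth (n : ℕ) :
    angLap (azimuth n).1 = -((n : MvPolynomial (Fin 3) ℝ) * (n + 1)) * (azimuth n).1 ∧
      angLap (azimuth n).2 = -((n : MvPolynomial (Fin 3) ℝ) * (n + 1)) * (azimuth n).2 := by
  induction n with
  | zero => simp [azimuth, angLap]
  | succ n ih =>
    obtain ⟨h1, h2⟩ := ih
    obtain ⟨h3, h4⟩ := angPair_X_azimuth n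
    simp only [azimuth, angLap_sub, angLap_add, angLap_mul, angLap_X, h1, h2] at h3 h4 ⊢
    push_cast
    constructor
    · linear_combination 2 * h3
    · linear_combination 2 * h4

/-- `P_l^{(n)}(X₂) G` is an eigenfunction of `L · L` on the unit sphere if `G` is one of the two
components of `azimuth n`. -/
lemma angLap_legendreP_mul (l n : ℕ) (G : MvPolynomial (Fin 3) ℝ)
    (h1 : angPair (MvPolynomial.X 2) G = -(n : MvPolynomial (Fin 3) ℝ) * MvPolynomial.X 2 * G)
    (h2 : angLap G = -((n : MvPolynomial (Fin 3) ℝ) * (n + 1)) * G) :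
    angLap (aeval (MvPolynomial.X 2) (derivative^[n] (legendreP l)) * G) =
      -((l : MvPolynomial (Fin 3) ℝ) * ((l : MvPolynomial (Fin 3) ℝ) + 1)) *
        (aeval (MvPolynomial.X 2) (derivative^[n] (legendreP l)) * G) +
      (∑ k, MvPolynomial.X k ^ 2 - 1) *
        (aeval (MvPolynomial.X 2) (derivative^[n + 2] (legendreP l)) * G) := by
  -- The Legendre equation has the coefficient `1 - X₂²`, whereas `LX₂ · LX₂ = |x|² - X₂²`; the
  -- difference is the last summand of the claim, which vanishes on the sphere.
  have h := congrArg (aeval (MvPolynomial.X 2 : MvPolynomial (Fin 3) ℝ))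
    (iterate_derivative_legendreP l n)
  rw [angLap_mul, angLap_aeval, angPair_aeval, h1, h2, angPair_X, angLap_X,
    ← Function.iterate_succ_apply' (f := derivative),
    ← Function.iterate_succ_apply' (f := derivative)]
  simp [map_ofNat] at h ⊢
  linear_combination -G * h

/-! ### Polynomial functions and their gradients -/

/-- The polynomial function on `ℝ³` that belongs to a polynomial in three variables. -/
def evalAt (F : MvPolynomial (Fin 3) ℝ) (x : E3) : ℝ := MvPolynomial.eval x.ofLp F

@[simp] lemma evalAt_add (F G : MvPolynomial (Fin 3) ℝ) (x : E3) :
    evalAt (F + G) x = evalAt F x + evalAt G x := by simp [evalAt]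

@[simp] lemma evalAt_sub (F G : MvPolynomial (Fin 3) ℝ) (x : E3) :
    evalAt (F - G) x = evalAt F x - evalAt G x := by simp [evalAt]

@[simp] lemma evalAt_mul (F G : MvPolynomial (Fin 3) ℝ) (x : E3) :
    evalAt (F * G) x = evalAt F x * evalAt G x := by simp [evalAt]

@[simp] lemma evalAt_X (i : Fin 3) (x : E3) : evalAt (MvPolynomial.X i) x = x i := by
  simp [evalAt]

@[simp] lemma evalAt_C (a : ℝ) (x : E3) : evalAt (MvPolynomial.C a) x = a := by
  simp [evalAt]

@[simp] lemma evalAt_zero (x : E3) : evalAt 0 x = 0 := by simp [evalAt]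

@[simp] lemma evalAt_one (x : E3) : evalAt 1 x = 1 := by simp [evalAt]

@[simp] lemma evalAt_sum {ι : Type*} (s : Finset ι) (F : ι → MvPolynomial (Fin 3) ℝ) (x : E3) :
    evalAt (∑ i ∈ s, F i) x = ∑ i ∈ s, evalAt (F i) x := by simp [evalAt]

lemma evalAt_aeval (p : ℝ[X]) (F : MvPolynomial (Fin 3) ℝ) (x : E3) :
    evalAt (aeval F p) x = p.eval (evalAt F x) := by
  induction p using Polynomial.induction_on' with
  | add p q hp hq => simp [hp, hq]
  | monomial n a => simp [evalAt, aeval_monomial]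

@[fun_prop] lemma continuous_evalAt (F : MvPolynomial (Fin 3) ℝ) : Continuous (evalAt F) := by
  unfold evalAt
  exact (MvPolynomial.continuous_eval F).comp (by fun_prop)

/-- The gradient of a polynomial function. -/
def polyGrad (F : MvPolynomial (Fin 3) ℝ) (x : E3) : E3 :=
  WithLp.toLp 2 fun i => evalAt (MvPolynomial.pderiv i F) x

@[fun_prop] lemma continuous_polyGrad (F : MvPolynomial (Fin 3) ℝ) : Continuous (polyGrad F) := by
  unfold polyGrad
  fun_prop

lemma inner_eq_sum (x y : E3) : inner ℝ x y = x 0 * y 0 + x 1 * y 1 + x 2 * y 2 := by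
  simp [PiLp.inner_apply, Fin.sum_univ_three, mul_comm]

lemma hasGradientAt_evalAt (F : MvPolynomial (Fin 3) ℝ) (x : E3) :
    HasGradientAt (evalAt F) (polyGrad F x) x := by
  rw [hasGradientAt_iff_hasFDerivAt]
  induction F using MvPolynomial.induction_on with
  | C a =>
    have h1 : evalAt (MvPolynomial.C a) = fun _ => a := by ext; simp
    have h2 : polyGrad (MvPolynomial.C a) x = 0 := by ext i; simp [polyGrad, evalAt]
    rw [h1, h2, map_zero]
    exact hasFDerivAt_const a x
  | add F G hF hG =>
    have h1 : evalAt (F + G) = evalAt F + evalAt G := by ext; simp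
    have h2 : polyGrad (F + G) x = polyGrad F x + polyGrad G x := by ext i; simp [polyGrad]
    rw [h1, h2, map_add]
    exact hF.add hG
  | mul_X F i hF =>
    have h1 : evalAt (F * MvPolynomial.X i) = fun x => evalAt F x * x i := by ext; simp
    have h3 : HasFDerivAt (fun x : E3 => x i) (EuclideanSpace.proj i : E3 →L[ℝ] ℝ) x :=
      (EuclideanSpace.proj i : E3 →L[ℝ] ℝ).hasFDerivAt
    rw [h1]
    refine (hF.mul h3).congr_fderiv ?_
    ext v
    simp only [add_apply, smul_apply,
      InnerProductSpace.toDual_apply_apply, inner_eq_sum, polyGrad, MvPolynomial.pderiv_mul,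
      evalAt_add, evalAt_mul, MvPolynomial.pderiv_X, evalAt_X, smul_eq_mul]
    fin_cases i <;> simp [evalAt] <;> ring

lemma gradient_evalAt (F : MvPolynomial (Fin 3) ℝ) (x : E3) :
    gradient (evalAt F) x = polyGrad F x := (hasGradientAt_evalAt F x).gradient

lemma hasDerivAt_evalAt_comp {c : ℝ → E3} {c' : E3} {θ : ℝ} (hc : HasDerivAt c c' θ)
    (F : MvPolynomial (Fin 3) ℝ) :
    HasDerivAt (fun s => evalAt F (c s)) (inner ℝ (polyGrad F (c θ)) c') θ := by
  have h := (hasGradientAt_evalAt F (c θ)).hasFDerivAt.comp_hasDerivAt θ hc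
  simp only [InnerProductSpace.toDual_apply_apply] at h
  exact h

/-! ### The surface measure -/

instance : IsFiniteMeasure surf := by unfold surf; infer_instance

instance : surf.IsOpenPosMeasure := by unfold surf; infer_instance

lemma surf_real_univ : surf.real Set.univ = 4 * Real.pi := by
  unfold surf
  rw [Measure.toSphere_real_apply_univ, measureReal_def, EuclideanSpace.volume_ball_fin_three]
  simp only [finrank_euclideanSpace, Fintype.card_fin]
  rw [ENNReal.ofReal_one, one_pow, one_mul, ENNReal.toReal_ofReal (by positivity)]
  push_cast
  ring

lemma integrable_surf {E : Type*} [NormedAddCommGroup E] {f : S2 → E} (hf : Continuous f) :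
    Integrable f surf :=
  hf.integrable_of_hasCompactSupport (HasCompactSupport.of_compactSpace f)

/-- The action of a linear isometry on the sphere. -/
def sphereMap (e : E3 ≃ₗᵢ[ℝ] E3) : S2 ≃ₜ S2 where
  toFun x := ⟨e x, by simp⟩
  invFun x := ⟨e.symm x, by simp⟩
  left_inv x := by simp
  right_inv x := by simp
  continuous_toFun := by fun_prop
  continuous_invFun := by fun_prop

/-- The surface measure of a set is a multiple of the volume of the cone over it, and an isometry
maps cones to cones and preserves volume. -/
lemma measurePreserving_sphereMap (e : E3 ≃ₗᵢ[ℝ] E3) :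
    MeasurePreserving (sphereMap e) surf surf := by
  refine ⟨(sphereMap e).continuous.measurable, ?_⟩
  ext s hs
  rw [Measure.map_apply (sphereMap e).continuous.measurable hs, surf,
    Measure.toSphere_apply' _ ((sphereMap e).continuous.measurable hs),
    Measure.toSphere_apply' _ hs]
  congr 1
  rw [← e.symm.measurePreserving.measure_preimage_equiv (f := e.symm.toMeasurableEquiv)]
  congr 1
  ext v
  simp only [Set.mem_smul, Set.mem_image, Set.mem_preimage]
  constructor
  · rintro ⟨r, hr, _, ⟨x, hx, rfl⟩, h⟩
    have h' : r • (x : E3) = e.symm v := h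
    refine ⟨r, hr, _, ⟨sphereMap e x, hx, rfl⟩, ?_⟩
    rw [← e.apply_symm_apply v, ← h']
    simp [sphereMap]
  · rintro ⟨r, hr, _, ⟨x, hx, rfl⟩, h⟩
    refine ⟨r, hr, _, ⟨(sphereMap e).symm x, by simpa using hx, rfl⟩, ?_⟩
    rw [← h]
    change r • e.symm x = e.symm (r • (x : E3))
    simp

lemma integral_surf_sphereMap (e : E3 ≃ₗᵢ[ℝ] E3) (f : S2 → ℝ) :
    ∫ x, f (sphereMap e x) ∂surf = ∫ x, f x ∂surf :=
  (measurePreserving_sphereMap e).integral_comp (sphereMap e).measurableEmbedding f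

lemma hasDerivAt_integral_surf {G G' : ℝ → S2 → ℝ} (hG : Continuous (Function.uncurry G))
    (hG' : Continuous (Function.uncurry G')) (h : ∀ θ x, HasDerivAt (fun s => G s x) (G' θ x) θ)
    (θ : ℝ) : HasDerivAt (fun s => ∫ x, G s x ∂surf) (∫ x, G' θ x ∂surf) θ := by
  obtain ⟨B, hB⟩ := ((isCompact_Icc (a := θ - 1) (b := θ + 1)).prod
    (isCompact_univ (X := S2))).exists_bound_of_continuousOn hG'.continuousOn
  refine (hasDerivAt_integral_of_dominated_loc_of_deriv_le (bound := fun _ => B)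
    (Icc_mem_nhds (by linarith : θ - 1 < θ) (by linarith : θ < θ + 1)) ?_ ?_ ?_ ?_ ?_ ?_).2
  · exact .of_forall fun s =>
      (hG.comp (by fun_prop : Continuous fun x : S2 => (s, x))).aestronglyMeasurable
  · exact integrable_surf (hG.comp (by fun_prop : Continuous fun x : S2 => (θ, x)))
  · exact (hG'.comp (by fun_prop : Continuous fun x : S2 => (θ, x))).aestronglyMeasurable
  · exact .of_forall fun x s hs => hB (s, x) ⟨hs, trivial⟩
  · exact integrable_const B
  · exact .of_forall fun x s _ => h s x

/-! ### Rotations and their infinitesimal generators. -/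

/-- The value at `x` of the rotation about the coordinate axis `i` by the angle `θ`. -/
def rotVec (i : Fin 3) (θ : ℝ) (x : E3) : E3 :=
  WithLp.toLp 2 fun j => if j = i then x i
    else if j = i + 1 then Real.cos θ * x (i + 1) - Real.sin θ * x (i + 2)
    else Real.sin θ * x (i + 1) + Real.cos θ * x (i + 2)

lemma norm_rotVec (i : Fin 3) (θ : ℝ) (x : E3) : ‖rotVec i θ x‖ = ‖x‖ := by
  rw [EuclideanSpace.norm_eq, EuclideanSpace.norm_eq]
  congr 1
  simp only [Fin.sum_univ_three, Real.norm_eq_abs, sq_abs, rotVec]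
  have h := Real.sin_sq_add_cos_sq θ
  fin_cases i <;>
    simp [show (1 : Fin 3) + 2 = 0 from rfl, show (2 : Fin 3) + 1 = 0 from rfl,
      show (1 : Fin 3) + 1 = 2 from rfl, show (2 : Fin 3) + 2 = 1 from rfl]
  · linear_combination (x 1 ^ 2 + x 2 ^ 2) * h
  · linear_combination (x 2 ^ 2 + x 0 ^ 2) * h
  · linear_combination (x 0 ^ 2 + x 1 ^ 2) * h

/-- The rotation about the coordinate axis `i` by the angle `θ`. -/
def rot (i : Fin 3) (θ : ℝ) : E3 ≃ₗᵢ[ℝ] E3 :=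
  LinearIsometry.toLinearIsometryEquiv
    { toFun := rotVec i θ
      map_add' := fun x y => by ext j; simp only [rotVec, PiLp.add_apply]; split_ifs <;> ring
      map_smul' := fun a x => by
        ext j; simp only [rotVec, PiLp.smul_apply, smul_eq_mul, RingHom.id_apply]
        split_ifs <;> ring
      norm_map' := norm_rotVec i θ } rfl

/-- The velocity of the rotation is `e_i × x`, and `∇F · (e_i × x) = (x × ∇F)_i`: angular
derivatives generate the rotations. -/
lemma hasDerivAt_rotVec (i : Fin 3) (θ : ℝ) (x : E3) (F : MvPolynomial (Fin 3) ℝ) :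
    HasDerivAt (fun s => evalAt F (rotVec i s x)) (evalAt (angDeriv i F) (rotVec i θ x)) θ := by
  have h : HasDerivAt (fun s => rotVec i s x) (WithLp.toLp 2 fun j => if j = i then 0
    else if j = i + 1 then -Real.sin θ * x (i + 1) - Real.cos θ * x (i + 2)
    else Real.cos θ * x (i + 1) + -Real.sin θ * x (i + 2)) θ := by
    have hp : HasDerivAt (fun s => (rotVec i s x).ofLp) (fun j => if j = i then 0
        else if j = i + 1 then -Real.sin θ * x (i + 1) - Real.cos θ * x (i + 2)
        else Real.cos θ * x (i + 1) + -Real.sin θ * x (i + 2)) θ := by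
      refine hasDerivAt_pi.2 fun j => ?_
      simp only [rotVec]
      split_ifs
      · exact hasDerivAt_const _ _
      · exact ((Real.hasDerivAt_cos θ).mul_const _).sub ((Real.hasDerivAt_sin θ).mul_const _)
      · exact ((Real.hasDerivAt_sin θ).mul_const _).add ((Real.hasDerivAt_cos θ).mul_const _)
    exact (PiLp.hasFDerivAt_toLp (𝕜 := ℝ) 2 _).comp_hasDerivAt θ hp
  convert hasDerivAt_evalAt_comp h F using 1
  simp only [inner_eq_sum, polyGrad, angDeriv_apply, evalAt_sub, evalAt_mul, evalAt_X]
  fin_cases i <;>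
    simp [rotVec, show (1 : Fin 3) + 2 = 0 from rfl, show (2 : Fin 3) + 1 = 0 from rfl,
      show (1 : Fin 3) + 1 = 2 from rfl, show (2 : Fin 3) + 2 = 1 from rfl] <;> ring

/-- Angular derivatives have integral zero over the sphere. -/
lemma integral_angDeriv (i : Fin 3) (F : MvPolynomial (Fin 3) ℝ) :
    ∫ x : S2, evalAt (angDeriv i F) x ∂surf = 0 := by
  have hc : Continuous fun p : ℝ × S2 => rotVec i p.1 p.2 := by
    unfold rotVec
    refine (PiLp.continuous_toLp 2 _).comp (continuous_pi fun j => ?_)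
    split_ifs <;> fun_prop
  have h := hasDerivAt_integral_surf (G := fun s x => evalAt F (rotVec i s x))
    (G' := fun s x => evalAt (angDeriv i F) (rotVec i s x))
    ((continuous_evalAt F).comp hc) ((continuous_evalAt _).comp hc)
    (fun θ x => hasDerivAt_rotVec i θ x F) 0
  -- Rotation invariance makes the integral constant in the angle, so its derivative at `0` is zero.
  have h1 : (fun s => ∫ x : S2, evalAt F (rotVec i s x) ∂surf) =
      fun _ => ∫ x : S2, evalAt F x ∂surf := by
    ext s
    exact integral_surf_sphereMap (rot i s) fun x => evalAt F x
  rw [h1] at h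
  have h2 := h.unique (hasDerivAt_const 0 _)
  rw [← h2]
  refine integral_congr_ae (.of_forall fun x => ?_)
  simp only
  congr 1
  ext j
  simp only [rotVec, Real.cos_zero, Real.sin_zero]
  fin_cases i <;> fin_cases j <;>
    simp [show (1 : Fin 3) + 2 = 0 from rfl, show (2 : Fin 3) + 1 = 0 from rfl,
      show (1 : Fin 3) + 1 = 2 from rfl, show (2 : Fin 3) + 2 = 1 from rfl]

/-! ### The Funk–Hecke formula for polynomial kernels -/

/-- The linear form `x ↦ x · y`. -/
def dotPoly (y : E3) : MvPolynomial (Fin 3) ℝ := ∑ i, MvPolynomial.C (y i) * MvPolynomial.X i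

lemma evalAt_dotPoly (x y : E3) : evalAt (dotPoly y) x = inner ℝ x y := by
  simp [dotPoly, inner_eq_sum, Fin.sum_univ_three, mul_comm]

lemma cross_apply_zero (x y : E3) : cross x y 0 = x 1 * y 2 - x 2 * y 1 := by
  simp [cross, crossProduct]

lemma cross_apply_one (x y : E3) : cross x y 1 = x 2 * y 0 - x 0 * y 2 := by
  simp [cross, crossProduct]

lemma cross_apply_two (x y : E3) : cross x y 2 = x 0 * y 1 - x 1 * y 0 := by
  simp [cross, crossProduct]

lemma evalAt_angDeriv (i : Fin 3) (F : MvPolynomial (Fin 3) ℝ) (x : E3) :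
    evalAt (angDeriv i F) x = cross x (polyGrad F x) i := by
  fin_cases i <;>
    simp [angDeriv_apply, polyGrad, cross_apply_zero, cross_apply_one, cross_apply_two,
      show (1 : Fin 3) + 2 = 0 from rfl, show (2 : Fin 3) + 1 = 0 from rfl,
      show (1 : Fin 3) + 1 = 2 from rfl, show (2 : Fin 3) + 2 = 1 from rfl]

lemma polyGrad_dotPoly (x y : E3) : polyGrad (dotPoly y) x = y := by
  ext i
  fin_cases i <;> simp [polyGrad, dotPoly, Fin.sum_univ_three, MvPolynomial.pderiv_X]

lemma evalAt_angDeriv_dotPoly (i : Fin 3) (x y : E3) :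
    evalAt (angDeriv i (dotPoly y)) x = cross x y i := by
  rw [evalAt_angDeriv, polyGrad_dotPoly]

lemma angLap_dotPoly (y : E3) : angLap (dotPoly y) = -2 * dotPoly y := by
  simp only [dotPoly, Fin.sum_univ_three, angLap_add, angLap_C_mul, angLap_X]
  ring

lemma norm_sphere (x : S2) : (x : E3) 0 * (x : E3) 0 + (x : E3) 1 * (x : E3) 1 +
    (x : E3) 2 * (x : E3) 2 = 1 := by
  rw [← inner_eq_sum, real_inner_self_eq_norm_sq, norm_eq_of_mem_sphere, one_pow]

/-! ### The Legendre operator as the zonal part of the spherical Laplacian. -/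

/-- The Legendre differential operator. -/
def legendreOp (p : ℝ[X]) : ℝ[X] := derivative ((1 - X ^ 2) * derivative p)

lemma legendreOp_eq (p : ℝ[X]) :
    legendreOp p = (1 - X ^ 2) * derivative (derivative p) - 2 * X * derivative p := by
  simp [legendreOp]
  ring

/-- The chain rule with `|L(x·y)|² = |x × y|² = 1 - t²` and `L·L (x·y) = -2t` yields `(1 - t²) p'' -
2t p'`. -/
lemma evalAt_angLap_zonal (p : ℝ[X]) (x y : S2) :
    evalAt (angLap (aeval (dotPoly y) p)) x = (legendreOp p).eval (inner ℝ (x : E3) (y : E3)) := by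
  have h2 : evalAt (-2 : MvPolynomial (Fin 3) ℝ) x = -2 := by simp [evalAt]
  rw [angLap_aeval, angLap_dotPoly, legendreOp_eq]
  simp only [angPair, evalAt_add, evalAt_mul, evalAt_aeval, evalAt_angDeriv_dotPoly,
    Fin.sum_univ_three, cross_apply_zero, cross_apply_one, cross_apply_two, evalAt_dotPoly, h2]
  simp [inner_eq_sum]
  have hx := norm_sphere x
  have hy := norm_sphere y
  generalize (eval _ (derivative (derivative p))) = P
  generalize (eval _ (derivative p)) = Q
  linear_combination P * (((y : E3) 0 * (y : E3) 0 + (y : E3) 1 * (y : E3) 1 +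
    (y : E3) 2 * (y : E3) 2) * hx + hy)

lemma integrable_evalAt (F : MvPolynomial (Fin 3) ℝ) :
    Integrable (fun x : S2 => evalAt F x) surf :=
  integrable_surf (by fun_prop)

/-- Integration by parts: the sum of both integrands is `∑ L_i (F L_i G)`. -/
lemma integral_mul_angLap (F G : MvPolynomial (Fin 3) ℝ) :
    ∫ x : S2, evalAt (F * angLap G) x ∂surf = -∫ x : S2, evalAt (angPair F G) x ∂surf := by
  rw [eq_neg_iff_add_eq_zero, ← integral_add (integrable_evalAt _) (integrable_evalAt _)]
  have h : ∀ x : S2, evalAt (F * angLap G) x + evalAt (angPair F G) x =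
      ∑ i, evalAt (angDeriv i (F * angDeriv i G)) x := by
    intro x
    simp [angLap, angPair, Finset.mul_sum, Finset.sum_add_distrib, add_comm, mul_comm]
  simp_rw [h]
  rw [integral_finsetSum _ fun i _ => integrable_evalAt _]
  exact Finset.sum_eq_zero fun i _ => integral_angDeriv i _

lemma integral_mul_angLap_comm (F G : MvPolynomial (Fin 3) ℝ) :
    ∫ x : S2, evalAt (F * angLap G) x ∂surf = ∫ x : S2, evalAt (G * angLap F) x ∂surf := by
  have h : angPair F G = angPair G F := by simp only [angPair, mul_comm]
  rw [integral_mul_angLap, integral_mul_angLap, h]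

/-- The functional `p ↦ ∫ p(x · y) F(x) dμ(x)`. -/
def sphereFunctional (F : MvPolynomial (Fin 3) ℝ) (y : E3) : ℝ[X] →ₗ[ℝ] ℝ where
  toFun p := ∫ x : S2, p.eval (inner ℝ (x : E3) y) * evalAt F x ∂surf
  map_add' p q := by
    rw [← integral_add (integrable_surf (by fun_prop)) (integrable_surf (by fun_prop))]
    simp [add_mul]
  map_smul' a p := by
    simp [← integral_const_mul, mul_assoc]

lemma sphereFunctional_apply (F : MvPolynomial (Fin 3) ℝ) (y : E3) (p : ℝ[X]) :
    sphereFunctional F y p = ∫ x : S2, p.eval (inner ℝ (x : E3) y) * evalAt F x ∂surf := rfl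

/-- The functional `p ↦ p̂(l)`. -/
def legendreFunctional (l : ℕ) : ℝ[X] →ₗ[ℝ] ℝ where
  toFun p := zonalCoeff (fun t => p.eval t) l
  map_add' p q := by
    simp only [zonalCoeff]
    rw [← mul_add, ← intervalIntegral.integral_add]
    · simp [add_mul]
    · exact Continuous.intervalIntegrable (by fun_prop) _ _
    · exact Continuous.intervalIntegrable (by fun_prop) _ _
  map_smul' a p := by
    simp only [zonalCoeff, eval_smul, smul_eq_mul, RingHom.id_apply, mul_assoc,
      intervalIntegral.integral_const_mul]
    ring

lemma legendreFunctional_apply (l : ℕ) (p : ℝ[X]) :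
    legendreFunctional l p = zonalCoeff (fun t => p.eval t) l := rfl

/-- The relation satisfied by eigenfunctions of `L · L` with eigenvalue `-l(l+1)` on the sphere. -/
def IsEigen (l : ℕ) (F : MvPolynomial (Fin 3) ℝ) : Prop :=
  ∀ x : S2, evalAt (angLap F) x = -eigenval l * evalAt F x

lemma sphereFunctional_legendreOp {l : ℕ} {F : MvPolynomial (Fin 3) ℝ} (hF : IsEigen l F) (y : S2)
    (p : ℝ[X]) :
    sphereFunctional F y (legendreOp p) = -eigenval l * sphereFunctional F y p := by
  rw [sphereFunctional_apply, sphereFunctional_apply, ← integral_const_mul]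
  have h := integral_mul_angLap_comm F (aeval (dotPoly y) p)
  simp only [evalAt_mul, evalAt_angLap_zonal, hF _, evalAt_aeval, evalAt_dotPoly] at h
  refine Eq.trans ?_ (h.trans ?_) <;> (congr 1; ext x; ring)

lemma legendreOp_legendreP (l : ℕ) : legendreOp (legendreP l) = C (-eigenval l) * legendreP l := by
  have h := iterate_derivative_legendreP l 0
  rw [legendreOp_eq]
  simp [eigenval] at h ⊢
  linear_combination -h

lemma integral_eval_derivative (p : ℝ[X]) (a b : ℝ) :
    ∫ t in a..b, (derivative p).eval t = p.eval b - p.eval a :=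
  intervalIntegral.integral_eq_sub_of_hasDerivAt (fun t _ => p.hasDerivAt t)
    (Continuous.intervalIntegrable (by fun_prop) _ _)

lemma legendreFunctional_legendreOp (l : ℕ) (p : ℝ[X]) :
    legendreFunctional l (legendreOp p) = -eigenval l * legendreFunctional l p := by
  -- Lagrange's identity: the boundary terms vanish because of the factor `1 - X²`.
  have h := integral_eval_derivative
    ((1 - X ^ 2) * (derivative p * legendreP l - p * derivative (legendreP l))) (-1) 1
  have h1 : derivative ((1 - X ^ 2) * (derivative p * legendreP l - p * derivative (legendreP l))) =
      legendreOp p * legendreP l - p * legendreOp (legendreP l) := by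
    simp only [legendreOp, derivative_mul, derivative_sub]
    ring
  rw [h1, legendreOp_legendreP] at h
  simp only [eval_sub, eval_mul, eval_C, eval_one, eval_pow, eval_X] at h
  rw [intervalIntegral.integral_sub (Continuous.intervalIntegrable (by fun_prop) _ _)
    (Continuous.intervalIntegrable (by fun_prop) _ _)] at h
  have h2 : ∫ t in (-1 : ℝ)..1, p.eval t * (-eigenval l * (legendreP l).eval t) =
      -eigenval l * ∫ t in (-1 : ℝ)..1, p.eval t * (legendreP l).eval t := by
    rw [← intervalIntegral.integral_const_mul]
    congr 1; ext t; ring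
  rw [h2] at h
  simp only [legendreFunctional_apply, zonalCoeff]
  linear_combination 2 * Real.pi * h

lemma legendreFunctional_one {l : ℕ} (hl : l ≠ 0) : legendreFunctional l 1 = 0 := by
  have h := legendreFunctional_legendreOp l 1
  have h1 : legendreOp 1 = 0 := by simp [legendreOp]
  have h2 : eigenval l ≠ 0 := by unfold eigenval; positivity
  rw [h1, map_zero] at h
  simpa [h2] using h.symm

/-- A functional that is an eigenvector of the transpose of the Legendre operator is determined by
one value. -/
lemma functional_eq_zero {l : ℕ} {N : ℝ[X] →ₗ[ℝ] ℝ}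
    (hN : ∀ p, N (legendreOp p) = -eigenval l * N p) (h0 : N (X ^ l) = 0) : N = 0 := by
  -- The Legendre operator sends `X ^ n` to `n (n - 1) X ^ (n - 2) - λ_n X ^ n`. Since `λ_n ≠ λ_l`
  -- for `n ≠ l`, the value at `X ^ n` is determined by the value at `X ^ (n - 2)`; only `n = l` is
  -- free.
  have key : ∀ n : ℕ, n ≠ l → ∀ r : ℝ[X], N r = 0 →
      legendreOp (X ^ n) = r - C (eigenval n) * X ^ n → N (X ^ n) = 0 := by
    intro n hn r hr h
    have h1 := hN (X ^ n)
    rw [h, map_sub, hr, ← smul_eq_C_mul, map_smul, smul_eq_mul] at h1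
    have h2 : (eigenval l - eigenval n) * N (X ^ n) = 0 := by linear_combination h1
    refine (mul_eq_zero.1 h2).resolve_left fun h3 => hn ?_
    have h4 : ((n : ℝ) - l) * (n + l + 1) = 0 := by
      unfold eigenval at h3; linear_combination -h3
    have h5 : (n : ℝ) + l + 1 ≠ 0 := by positivity
    exact_mod_cast sub_eq_zero.1 ((mul_eq_zero.1 h4).resolve_right h5)
  have main : ∀ n : ℕ, N (X ^ n) = 0 ∧ N (X ^ (n + 1)) = 0 := by
    intro n
    induction n with
    | zero =>
      constructor
      · by_cases h : 0 = l
        · rwa [← h] at h0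
        · exact key 0 h 0 (map_zero N) (by simp [legendreOp, eigenval])
      · by_cases h : 1 = l
        · rwa [← h] at h0
        · refine key 1 h 0 (map_zero N) ?_
          simp [legendreOp_eq, eigenval, show (C (1 + 1) : ℝ[X]) = 2 by simp; norm_num]
    | succ n ih =>
      refine ⟨ih.2, ?_⟩
      by_cases h : n + 2 = l
      · rwa [← h] at h0
      · refine key (n + 2) h (C (((n : ℝ) + 2) * (n + 1)) * X ^ n) ?_ ?_
        · rw [← smul_eq_C_mul, map_smul, ih.1, smul_zero]
        · simp [legendreOp_eq, eigenval, map_ofNat]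
          ring
  refine Polynomial.lhom_ext' fun n => LinearMap.ext_ring ?_
  simpa [monomial_one_right_eq_X_pow] using (main n).1

lemma isEigen_one : IsEigen 0 1 := fun x => by simp [angLap, eigenval, evalAt]

/-- Archimedes' hat-box theorem for polynomials. -/
lemma sphereFunctional_one (y : S2) : sphereFunctional 1 y = legendreFunctional 0 := by
  rw [← sub_eq_zero]
  refine functional_eq_zero (l := 0) (fun p => ?_) ?_
  · simp only [LinearMap.sub_apply, sphereFunctional_legendreOp isEigen_one,
      legendreFunctional_legendreOp]
    ring
  · simp [sphereFunctional_apply, legendreFunctional_apply, zonalCoeff, legendreP, evalAt,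
      surf_real_univ]
    ring

/-- The base `1 + x·y` is nonnegative with its only maximum at `x = y`, so its normalised powers are
an approximate identity at `y`. -/
lemma tendsto_peak (y : S2) {g : S2 → ℝ} (hg : Continuous g) :
    Filter.Tendsto (fun n : ℕ => (∫ x : S2, (1 + inner ℝ (x : E3) (y : E3)) ^ n ∂surf)⁻¹ *
      ∫ x : S2, (1 + inner ℝ (x : E3) (y : E3)) ^ n * g x ∂surf) Filter.atTop (nhds (g y)) := by
  have h := tendsto_setIntegral_pow_smul_of_unique_maximum_of_isCompact_of_continuousOn
    (μ := surf) (x₀ := y) (g := g) (isCompact_univ (X := S2))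
    (c := fun x : S2 => 1 + inner ℝ (x : E3) (y : E3)) (by fun_prop) ?_ ?_ ?_ (by simp)
    hg.continuousOn
  · simpa using h
  · intro x _ hxy
    have h1 := (inner_lt_one_iff_real_of_norm_eq_one (norm_eq_of_mem_sphere x)
      (norm_eq_of_mem_sphere y)).2 fun h => hxy (Subtype.ext h)
    have h2 : inner ℝ (y : E3) (y : E3) = (1 : ℝ) := by
      rw [real_inner_self_eq_norm_sq, norm_eq_of_mem_sphere, one_pow]
    simp only [h2]
    linarith
  · intro x _
    have h1 := neg_one_le_real_inner_of_norm_eq_one (norm_eq_of_mem_sphere x)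
      (norm_eq_of_mem_sphere y)
    linarith
  · have h2 : inner ℝ (y : E3) (y : E3) = (1 : ℝ) := by
      rw [real_inner_self_eq_norm_sq, norm_eq_of_mem_sphere, one_pow]
    rw [h2]; norm_num

/-- The Funk–Hecke formula for polynomial kernels. -/
lemma sphereFunctional_eq {l : ℕ} {F : MvPolynomial (Fin 3) ℝ} (hF : IsEigen l F) (y : S2)
    (p : ℝ[X]) : sphereFunctional F y p = legendreFunctional l p * evalAt F y := by
  set N : ℝ[X] →ₗ[ℝ] ℝ := sphereFunctional F y - evalAt F y • legendreFunctional l with hNdef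
  have hN : ∀ p, N (legendreOp p) = -eigenval l * N p := by
    intro p
    simp only [hNdef, LinearMap.sub_apply, LinearMap.smul_apply, smul_eq_mul,
      sphereFunctional_legendreOp hF, legendreFunctional_legendreOp]
    ring
  -- The defect `N` is an eigenfunctional as well. This combination of it with `legendreFunctional
  -- l` vanishes at `X ^ l`, hence everywhere.
  have hprop : ∀ p, legendreFunctional l (X ^ l) * N p = N (X ^ l) * legendreFunctional l p := by
    have h := functional_eq_zero (l := l)
      (N := legendreFunctional l (X ^ l) • N - N (X ^ l) • legendreFunctional l) (fun p => by
        simp only [LinearMap.sub_apply, LinearMap.smul_apply, smul_eq_mul, hN,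
          legendreFunctional_legendreOp]
        ring) (by
        simp only [LinearMap.sub_apply, LinearMap.smul_apply, smul_eq_mul]
        ring)
    intro p
    have := LinearMap.congr_fun h p
    simpa [sub_eq_zero] using this
  set a : ℕ → ℝ := fun n => (∫ x : S2, (1 + inner ℝ (x : E3) (y : E3)) ^ n ∂surf)⁻¹ with ha
  -- By the hat-box theorem this is the normalised sphere integral of `(1 + x·y) ^ n P_l(x·y)`,
  -- which tends to `P_l(1) = 1`.
  have hq : Filter.Tendsto (fun n => a n * legendreFunctional l ((1 + X) ^ n)) Filter.atTop
      (nhds 1) := by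
    have h := tendsto_peak y (g := fun x => (legendreP l).eval (inner ℝ (x : E3) (y : E3)))
      (by fun_prop)
    have h2 : inner ℝ (y : E3) (y : E3) = (1 : ℝ) := by
      rw [real_inner_self_eq_norm_sq, norm_eq_of_mem_sphere, one_pow]
    simp only [h2, eval_one_legendreP] at h
    refine h.congr fun n => ?_
    have h3 := LinearMap.congr_fun (sphereFunctional_one y) ((1 + X) ^ n * legendreP l)
    rw [sphereFunctional_apply, legendreFunctional_apply] at h3
    simp only [ha, legendreFunctional_apply]
    congr 1
    simpa [zonalCoeff, legendreP, evalAt, mul_assoc] using h3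
  have hA : Filter.Tendsto (fun n => a n * sphereFunctional F y ((1 + X) ^ n)) Filter.atTop
      (nhds (evalAt F y)) := by
    have h := tendsto_peak y (g := fun x => evalAt F x) (by fun_prop)
    refine h.congr fun n => ?_
    simp [ha, sphereFunctional_apply]
  have hNlim : Filter.Tendsto (fun n => a n * N ((1 + X) ^ n)) Filter.atTop (nhds 0) := by
    have h := hA.sub (hq.const_mul (evalAt F y))
    rw [mul_one, sub_self] at h
    refine h.congr fun n => ?_
    simp only [hNdef, LinearMap.sub_apply, LinearMap.smul_apply, smul_eq_mul]
    ring
  -- Along the peak sequence the two sides of `hprop` tend to `0` and to `N (X ^ l)`, so no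
  -- nonvanishing of `legendreFunctional l (X ^ l)` is needed.
  have h0 : N (X ^ l) = 0 := by
    have h1 := hNlim.const_mul (legendreFunctional l (X ^ l))
    have h2 := hq.const_mul (N (X ^ l))
    rw [mul_zero] at h1
    rw [mul_one] at h2
    refine tendsto_nhds_unique (h2.congr fun n => ?_) h1
    linear_combination -(a n) * hprop ((1 + X) ^ n)
  have := LinearMap.congr_fun (functional_eq_zero hN h0) p
  simp only [hNdef, LinearMap.sub_apply, LinearMap.smul_apply, smul_eq_mul,
    LinearMap.zero_apply] at this
  linarith

/-! ### The vector Funk–Hecke formula for polynomial kernels -/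

@[fun_prop] lemma continuous_cross : Continuous fun p : E3 × E3 => cross p.1 p.2 := by
  refine (PiLp.continuous_toLp 2 _).comp (continuous_pi fun j => ?_)
  fin_cases j <;> simp [crossProduct] <;> fun_prop

lemma Continuous.cross {α : Type*} [TopologicalSpace α] {f g : α → E3} (hf : Continuous f)
    (hg : Continuous g) : Continuous fun a => cross (f a) (g a) :=
  continuous_cross.comp (hf.prodMk hg)

lemma integral_dot_cross_polyGrad (G : MvPolynomial (Fin 3) ℝ) (y : E3) :
    ∫ x : S2, inner ℝ y (cross x (polyGrad G x)) ∂surf = 0 := by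
  simp only [inner_eq_sum, ← evalAt_angDeriv]
  have hi : ∀ i, Integrable (fun x : S2 => y i * evalAt (angDeriv i G) x) surf :=
    fun i => (integrable_evalAt _).const_mul _
  have h := integral_finsetSum Finset.univ fun i _ => hi i
  simpa [integral_const_mul, integral_angDeriv, Fin.sum_univ_three] using h

/-- The rotation generator `y · L` annihilates functions of `x·y`, so the zonal factor can be moved
under it. -/
lemma integral_zonal_dot_cross_polyGrad (k : ℝ[X]) (F : MvPolynomial (Fin 3) ℝ) (y : E3) :
    ∫ x : S2, k.eval (inner ℝ (x : E3) y) * inner ℝ y (cross x (polyGrad F x)) ∂surf = 0 := by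
  rw [← integral_dot_cross_polyGrad (aeval (dotPoly y) k * F) y]
  congr 1
  ext x
  simp only [inner_eq_sum, ← evalAt_angDeriv, angDeriv_mul, angDeriv_aeval, evalAt_add, evalAt_mul,
    evalAt_aeval, evalAt_angDeriv_dotPoly, evalAt_dotPoly, cross_apply_zero, cross_apply_one,
    cross_apply_two]
  ring

/-- The polynomial kernel `ψ` with `κ = h'`. -/
def kernelPoly (h : ℝ[X]) : ℝ[X] := C (1 / (4 * Real.pi)) - legendreOp h

/-- The integrand is `LF · L(h(x·y))`. Integration by parts leaves `-∫ F (legendreOp h)(x·y)`, to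
which scalar Funk–Hecke applies; the constant in `kernelPoly` has no component of degree `l ≠ 0`. -/
lemma integral_cross_dot_cross {l : ℕ} (hl : l ≠ 0) {F : MvPolynomial (Fin 3) ℝ} (hF : IsEigen l F)
    (h : ℝ[X]) (y : S2) :
    ∫ x : S2, (derivative h).eval (inner ℝ (x : E3) (y : E3)) *
      inner ℝ (cross x y) (cross x (polyGrad F x)) ∂surf =
    legendreFunctional l (kernelPoly h) * evalAt F y := by
  have h1 := integral_mul_angLap F (aeval (dotPoly y) h)
  have h2 := sphereFunctional_eq hF y (legendreOp h)
  rw [sphereFunctional_apply] at h2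
  rw [kernelPoly, map_sub, ← mul_one (C _), ← smul_eq_C_mul, map_smul, legendreFunctional_one hl,
    smul_zero, zero_sub, neg_mul, ← h2]
  simp only [evalAt_mul, evalAt_angLap_zonal] at h1
  rw [eq_neg_iff_add_eq_zero, add_comm, ← eq_neg_iff_add_eq_zero]
  refine Eq.trans ?_ (h1.trans ?_)
  · congr 1; ext x; ring
  · congr 2; ext x
    simp only [angPair, angDeriv_aeval, inner_eq_sum, evalAt_angDeriv, polyGrad_dotPoly,
      Fin.sum_univ_three, evalAt_add, evalAt_mul, evalAt_aeval, evalAt_dotPoly]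
    ring

lemma hasDerivAt_zonal_circle (k : ℝ[X]) (Z : S2 → E3) (hZ : Continuous Z) (y w : E3) :
    HasDerivAt (fun θ : ℝ => ∫ x : S2,
      k.eval (inner ℝ (x : E3) (Real.cos θ • y + Real.sin θ • w)) *
        inner ℝ (Real.cos θ • y + Real.sin θ • w) (Z x) ∂surf)
      (∫ x : S2, ((derivative k).eval (inner ℝ (x : E3) y) * inner ℝ (x : E3) w * inner ℝ y (Z x) +
        k.eval (inner ℝ (x : E3) y) * inner ℝ w (Z x)) ∂surf) 0 := by
  simp only [inner_add_left, inner_add_right, real_inner_smul_left, real_inner_smul_right]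
  have h := hasDerivAt_integral_surf
    (G := fun θ x => k.eval (Real.cos θ * inner ℝ (x : E3) y + Real.sin θ * inner ℝ (x : E3) w) *
      (Real.cos θ * inner ℝ y (Z x) + Real.sin θ * inner ℝ w (Z x)))
    (G' := fun θ x => (derivative k).eval
        (Real.cos θ * inner ℝ (x : E3) y + Real.sin θ * inner ℝ (x : E3) w) *
        (-Real.sin θ * inner ℝ (x : E3) y + Real.cos θ * inner ℝ (x : E3) w) *
        (Real.cos θ * inner ℝ y (Z x) + Real.sin θ * inner ℝ w (Z x)) +
      k.eval (Real.cos θ * inner ℝ (x : E3) y + Real.sin θ * inner ℝ (x : E3) w) *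
        (-Real.sin θ * inner ℝ y (Z x) + Real.cos θ * inner ℝ w (Z x)))
    (by unfold Function.uncurry; fun_prop) (by unfold Function.uncurry; fun_prop) (fun θ x => by
      have hd : ∀ a b : ℝ, HasDerivAt (fun s => Real.cos s * a + Real.sin s * b)
          (-Real.sin θ * a + Real.cos θ * b) θ := fun a b =>
        ((Real.hasDerivAt_cos θ).mul_const a).add ((Real.hasDerivAt_sin θ).mul_const b)
      exact ((k.hasDerivAt _).comp θ (hd _ _)).mul (hd _ _)) 0
  simpa using h

/-- Differentiation of `∫ k(x · y) y · Z(x) dμ(x)` along the sphere. -/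
lemma integral_zonal_deriv {k : ℝ[X]} {Z : S2 → E3} (hZ : Continuous Z) {a : ℝ}
    {F : MvPolynomial (Fin 3) ℝ} (hT : ∀ y : S2, ∫ x : S2,
      k.eval (inner ℝ (x : E3) (y : E3)) * inner ℝ (y : E3) (Z x) ∂surf = a * evalAt F y)
    (y : S2) {w : E3} (hw : inner ℝ (y : E3) w = 0) :
    ∫ x : S2, ((derivative k).eval (inner ℝ (x : E3) (y : E3)) * inner ℝ (x : E3) w *
        inner ℝ (y : E3) (Z x) + k.eval (inner ℝ (x : E3) (y : E3)) * inner ℝ w (Z x)) ∂surf =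
      a * inner ℝ (polyGrad F y) w := by
  -- For a unit tangent vector the curve `cos θ y + sin θ u` stays on the sphere, where `hT`
  -- applies; other `w` follow by homogeneity.
  have unit : ∀ u : E3, ‖u‖ = 1 → inner ℝ (y : E3) u = 0 →
      ∫ x : S2, ((derivative k).eval (inner ℝ (x : E3) (y : E3)) * inner ℝ (x : E3) u *
        inner ℝ (y : E3) (Z x) + k.eval (inner ℝ (x : E3) (y : E3)) * inner ℝ u (Z x)) ∂surf =
      a * inner ℝ (polyGrad F y) u := by
    intro u hu hyu
    have h1 := hasDerivAt_zonal_circle k Z hZ y u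
    have hmem : ∀ θ : ℝ, Real.cos θ • (y : E3) + Real.sin θ • u ∈ Metric.sphere (0 : E3) 1 := by
      intro θ
      rw [mem_sphere_zero_iff_norm, ← sq_eq_sq₀ (norm_nonneg _) zero_le_one,
        norm_add_sq_real, norm_smul, norm_smul, real_inner_smul_left, real_inner_smul_right, hyu,
        hu, norm_eq_of_mem_sphere]
      simp
    have hc : HasDerivAt (fun θ : ℝ => Real.cos θ • (y : E3) + Real.sin θ • u) u 0 := by
      have := ((Real.hasDerivAt_cos 0).smul_const (y : E3)).fun_add
        ((Real.hasDerivAt_sin 0).smul_const u)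
      simpa using this
    have h2 := (hasDerivAt_evalAt_comp hc F).const_mul a
    have h3 : (fun θ : ℝ => ∫ x : S2,
      k.eval (inner ℝ (x : E3) (Real.cos θ • (y : E3) + Real.sin θ • u)) *
        inner ℝ (Real.cos θ • (y : E3) + Real.sin θ • u) (Z x) ∂surf) =
        fun θ => a * evalAt F (Real.cos θ • (y : E3) + Real.sin θ • u) :=
      funext fun θ => hT ⟨_, hmem θ⟩
    rw [h3] at h1
    have h4 := h1.unique h2
    simpa using h4
  rcases eq_or_ne w 0 with rfl | hw0
  · simp
  have hn : ‖w‖ ≠ 0 := norm_ne_zero_iff.2 hw0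
  have h := unit (‖w‖⁻¹ • w) (by rw [norm_smul, norm_inv, norm_norm, inv_mul_cancel₀ hn])
    (by rw [real_inner_smul_right, hw, mul_zero])
  simp only [real_inner_smul_left, real_inner_smul_right] at h
  have h5 : ∫ x : S2, ((derivative k).eval (inner ℝ (x : E3) (y : E3)) * inner ℝ (x : E3) w *
        inner ℝ (y : E3) (Z x) + k.eval (inner ℝ (x : E3) (y : E3)) * inner ℝ w (Z x)) ∂surf =
      ‖w‖ * ∫ x : S2, ((derivative k).eval (inner ℝ (x : E3) (y : E3)) *
        (‖w‖⁻¹ * inner ℝ (x : E3) w) * inner ℝ (y : E3) (Z x) +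
        k.eval (inner ℝ (x : E3) (y : E3)) * (‖w‖⁻¹ * inner ℝ w (Z x))) ∂surf := by
    rw [← integral_const_mul]
    congr 1; ext x; field_simp
  rw [h5, h]
  field_simp

lemma surfGrad_evalAt (F : MvPolynomial (Fin 3) ℝ) (x : S2) :
    surfGrad (evalAt F) x = polyGrad F x - inner ℝ (x : E3) (polyGrad F x) • (x : E3) := by
  rw [surfGrad, gradient_evalAt]

lemma surfCurl_evalAt (F : MvPolynomial (Fin 3) ℝ) (x : S2) :
    surfCurl (evalAt F) x = cross x (polyGrad F x) := by
  rw [surfCurl, gradient_evalAt]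

lemma continuous_surfGrad (F : MvPolynomial (Fin 3) ℝ) : Continuous (surfGrad (evalAt F)) := by
  simp only [funext (surfGrad_evalAt F)]
  fun_prop

lemma continuous_surfCurl (F : MvPolynomial (Fin 3) ℝ) : Continuous (surfCurl (evalAt F)) := by
  simp only [funext (surfCurl_evalAt F)]
  exact Continuous.cross (by fun_prop) (by fun_prop)

lemma inner_surfGrad (F : MvPolynomial (Fin 3) ℝ) (x : S2) :
    inner ℝ (x : E3) (surfGrad (evalAt F) x) = 0 := by
  rw [surfGrad_evalAt, inner_sub_right, real_inner_smul_right, real_inner_self_eq_norm_sq,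
    norm_eq_of_mem_sphere]
  ring

lemma inner_surfCurl (F : MvPolynomial (Fin 3) ℝ) (x : S2) :
    inner ℝ (x : E3) (surfCurl (evalAt F) x) = 0 := by
  simp only [surfCurl_evalAt, inner_eq_sum, cross_apply_zero, cross_apply_one, cross_apply_two]
  ring

/-- The bilinear form `Z · Ψ(x, y) v` for `v` tangential at `y` and `Z` tangential at `x`, where `k`
and `k'` are the values of `κ` and `κ'` at `x · y`. -/
def kerForm (k k' : ℝ) (x y v Z : E3) : ℝ :=
  k' * (-(inner ℝ (cross x y) v * inner ℝ (cross x y) Z) + inner ℝ x v * inner ℝ y Z) +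
    k * (inner ℝ x y * inner ℝ v Z - inner ℝ x v * inner ℝ y Z + inner ℝ v Z)

/-- Both halves have the shape `k' (x·w) (y·Z') + k (w·Z')`, with `(w, Z') = (v, Z)` and `(v × y, Z
× x)`. This is the integrand that `integral_zonal_deriv` produces. -/
lemma kerForm_eq (k k' : ℝ) (x y v Z : E3) : kerForm k k' x y v Z =
    (k' * inner ℝ x v * inner ℝ y Z + k * inner ℝ v Z) +
      (k' * inner ℝ x (cross v y) * inner ℝ y (cross Z x) +
        k * inner ℝ (cross v y) (cross Z x)) := by
  simp only [kerForm, inner_eq_sum, cross_apply_zero, cross_apply_one, cross_apply_two]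
  ring

lemma integral_kerForm {h : ℝ[X]} {Z : S2 → E3} (hZ : Continuous Z) {a b : ℝ}
    {F : MvPolynomial (Fin 3) ℝ} (hT : ∀ y : S2, ∫ x : S2,
      (derivative h).eval (inner ℝ (x : E3) (y : E3)) * inner ℝ (y : E3) (Z x) ∂surf =
        a * evalAt F y)
    (hS : ∀ y : S2, ∫ x : S2,
      (derivative h).eval (inner ℝ (x : E3) (y : E3)) * inner ℝ (y : E3) (cross (Z x) x) ∂surf =
        b * evalAt F y)
    (y : S2) {v : E3} (hv : inner ℝ (y : E3) v = 0) :
    ∫ x : S2, kerForm ((derivative h).eval (inner ℝ (x : E3) (y : E3)))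
      ((derivative (derivative h)).eval (inner ℝ (x : E3) (y : E3))) x y v (Z x) ∂surf =
      a * inner ℝ (polyGrad F y) v + b * inner ℝ (polyGrad F y) (cross v y) := by
  have hZ' : Continuous fun x : S2 => cross (Z x) x := Continuous.cross hZ (by fun_prop)
  have h1 := integral_zonal_deriv hZ hT y hv
  have h2 := integral_zonal_deriv (w := cross v y) hZ' hS y (by
    simp only [inner_eq_sum, cross_apply_zero, cross_apply_one, cross_apply_two]; ring)
  rw [← h1, ← h2, ← integral_add (integrable_surf (by fun_prop)) (integrable_surf (by fun_prop))]
  simp only [kerForm_eq]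

/-- On the sphere `y · ∇_*F = (x × y) · (x × ∇F)`, which gives `a` by `integral_cross_dot_cross`.
The other pairing is `y · (∇_*F × x) = -y · (x × ∇F)`, whose zonal integrals vanish, so `b = 0`. -/
lemma integral_kerForm_surfGrad {l : ℕ} (hl : l ≠ 0) {F : MvPolynomial (Fin 3) ℝ}
    (hF : IsEigen l F) (h : ℝ[X]) (y : S2) {v : E3} (hv : inner ℝ (y : E3) v = 0) :
    ∫ x : S2, kerForm ((derivative h).eval (inner ℝ (x : E3) (y : E3)))
      ((derivative (derivative h)).eval (inner ℝ (x : E3) (y : E3))) x y v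
        (surfGrad (evalAt F) x) ∂surf =
      legendreFunctional l (kernelPoly h) * inner ℝ v (surfGrad (evalAt F) y) := by
  rw [integral_kerForm (continuous_surfGrad F) (a := legendreFunctional l (kernelPoly h)) (b := 0)
    (F := F) ?_ ?_ y hv]
  · rw [surfGrad_evalAt, inner_sub_right, real_inner_smul_right, real_inner_comm (y : E3) v, hv,
      real_inner_comm v]
    ring
  · intro y
    rw [← integral_cross_dot_cross hl hF]
    congr 1
    ext x
    congr 1
    simp only [surfGrad_evalAt, inner_eq_sum, cross_apply_zero, cross_apply_one, cross_apply_two,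
      PiLp.sub_apply, PiLp.smul_apply, smul_eq_mul]
    linear_combination ((y : E3) 0 * polyGrad F x 0 + (y : E3) 1 * polyGrad F x 1 +
      (y : E3) 2 * polyGrad F x 2) * -(norm_sphere x)
  · intro y
    rw [zero_mul, ← neg_eq_zero, ← integral_neg,
      ← integral_zonal_dot_cross_polyGrad (derivative h) F y]
    congr 1
    ext x
    simp only [surfGrad_evalAt, inner_eq_sum, cross_apply_zero, cross_apply_one, cross_apply_two,
      PiLp.sub_apply, PiLp.smul_apply, smul_eq_mul]
    ring

/-- The roles of `a` and `b` are exchanged, since `(x × ∇F) × x = ∇_*F`. -/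
lemma integral_kerForm_surfCurl {l : ℕ} (hl : l ≠ 0) {F : MvPolynomial (Fin 3) ℝ}
    (hF : IsEigen l F) (h : ℝ[X]) (y : S2) {v : E3} (hv : inner ℝ (y : E3) v = 0) :
    ∫ x : S2, kerForm ((derivative h).eval (inner ℝ (x : E3) (y : E3)))
      ((derivative (derivative h)).eval (inner ℝ (x : E3) (y : E3))) x y v
        (surfCurl (evalAt F) x) ∂surf =
      legendreFunctional l (kernelPoly h) * inner ℝ v (surfCurl (evalAt F) y) := by
  rw [integral_kerForm (continuous_surfCurl F) (a := 0) (b := legendreFunctional l (kernelPoly h))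
    (F := F) ?_ ?_ y hv]
  · simp only [surfCurl_evalAt, inner_eq_sum, cross_apply_zero, cross_apply_one, cross_apply_two]
    ring
  · intro y
    rw [zero_mul, ← integral_zonal_dot_cross_polyGrad (derivative h) F y]
    simp only [surfCurl_evalAt]
  · intro y
    rw [← integral_cross_dot_cross hl hF]
    congr 1
    ext x
    congr 1
    simp only [surfCurl_evalAt, inner_eq_sum, cross_apply_zero, cross_apply_one, cross_apply_two]
    ring

/-! ### Spherical harmonics as polynomials -/

/-- The polynomial that belongs to the spherical harmonic `Y_{l,k}`. -/
def harmPoly (l : ℕ) (k : Fin (2 * l + 1)) : MvPolynomial (Fin 3) ℝ :=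
  MvPolynomial.C (harmonicNorm l (orderOfIndex l k)) *
    (aeval (MvPolynomial.X 2) (derivative^[(orderOfIndex l k).natAbs] (legendreP l)) *
      (if 0 ≤ orderOfIndex l k then (azimuth (orderOfIndex l k).natAbs).1
        else (azimuth (orderOfIndex l k).natAbs).2))

lemma evalAt_azimuth (n : ℕ) (x : E3) :
    evalAt (azimuth n).1 x = ((⟨x 0, x 1⟩ : ℂ) ^ n).re ∧
      evalAt (azimuth n).2 x = ((⟨x 0, x 1⟩ : ℂ) ^ n).im := by
  induction n with
  | zero => simp [azimuth]
  | succ n ih =>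
    obtain ⟨h1, h2⟩ := ih
    rw [pow_succ', Complex.mul_re, Complex.mul_im, ← h1, ← h2]
    simp [azimuth]

lemma Y_eq_evalAt (l : ℕ) (k : Fin (2 * l + 1)) : Y l k = evalAt (harmPoly l k) := by
  ext x
  obtain ⟨h1, h2⟩ := evalAt_azimuth (orderOfIndex l k).natAbs x
  simp only [Y, harmPoly, evalAt_mul, evalAt_C, evalAt_aeval, evalAt_X, mul_assoc]
  split_ifs
  · rw [h1]
  · rw [h2]

lemma isEigen_harmPoly (l : ℕ) (k : Fin (2 * l + 1)) : IsEigen l (harmPoly l k) := by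
  intro x
  set n := (orderOfIndex l k).natAbs with hn
  have hx : evalAt (∑ k, MvPolynomial.X k ^ 2 - 1) (x : E3) = 0 := by
    have := norm_sphere x
    simp [Fin.sum_univ_three, pow_two]
    linarith
  have hl : evalAt (-((l : MvPolynomial (Fin 3) ℝ) * ((l : MvPolynomial (Fin 3) ℝ) + 1))) (x : E3) =
      -eigenval l := by
    simp [evalAt, eigenval]
  have key : ∀ (a : ℝ) (G : MvPolynomial (Fin 3) ℝ),
      angPair (MvPolynomial.X 2) G = -(n : MvPolynomial (Fin 3) ℝ) * MvPolynomial.X 2 * G →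
      angLap G = -((n : MvPolynomial (Fin 3) ℝ) * (n + 1)) * G →
      evalAt (angLap (MvPolynomial.C a *
        (aeval (MvPolynomial.X 2) (derivative^[n] (legendreP l)) * G))) x =
      -eigenval l * evalAt (MvPolynomial.C a *
        (aeval (MvPolynomial.X 2) (derivative^[n] (legendreP l)) * G)) x := by
    intro a G h1 h2
    rw [angLap_C_mul, angLap_legendreP_mul l n G h1 h2]
    generalize aeval (MvPolynomial.X 2) (derivative^[n] (legendreP l)) * G = H
    simp only [evalAt_mul, evalAt_add, hx, hl]
    ring
  unfold harmPoly
  split_ifs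
  · exact key _ _ (angPair_X_two_azimuth n).1 (angLap_azimuth n).1
  · exact key _ _ (angPair_X_two_azimuth n).2 (angLap_azimuth n).2

/-! ### The matrix kernel -/

/-- The vector `Ψ(x, y) v`, where `k` and `k'` are the values of `κ` and `κ'` at `x · y`. -/
def kerVec (k k' : ℝ) (x y v : E3) : E3 :=
  k' • (-(inner ℝ (cross x y) v • cross x y) +
      inner ℝ (x - inner ℝ x y • y) v • (y - inner ℝ x y • x)) +
    k • ((inner ℝ x y • v - inner ℝ x v • y) +
      ((v - inner ℝ y v • y) - inner ℝ x (v - inner ℝ y v • y) • x))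

lemma ker_mulVec (ψ : ℝ → ℝ) (x y : S2) (v : E3) :
    WithLp.toLp 2 (ker ψ x y *ᵥ v.ofLp) = kerVec (kappa ψ (inner ℝ (x : E3) (y : E3)))
      (deriv (kappa ψ) (inner ℝ (x : E3) (y : E3))) x y v := by
  have h : ∀ a b : E3, b.ofLp ⬝ᵥ a.ofLp = inner ℝ b a := by
    intro a b; simp [inner_eq_sum, dotProduct, Fin.sum_univ_three]
  have h2 : ∀ a b w : Fin 3 → ℝ, Matrix.vecMulVec a b *ᵥ w = (b ⬝ᵥ w) • a := by
    intro a b w; rw [Matrix.vecMulVec_mulVec]; ext i; simp [mul_comm]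
  apply WithLp.ofLp_injective 2
  simp only [ker, kerDiv, kerCurl, matQ, matR, matV, matW, kerVec, Matrix.add_mulVec,
    Matrix.smul_mulVec, Matrix.neg_mulVec, ← Matrix.mulVec_mulVec, Matrix.sub_mulVec,
    Matrix.one_mulVec, h2, WithLp.ofLp_add, WithLp.ofLp_smul, WithLp.ofLp_sub, WithLp.ofLp_neg,
    ← h]
  module

lemma kerVec_sub (k₁ k₁' k₂ k₂' : ℝ) (x y v : E3) :
    kerVec k₁ k₁' x y v - kerVec k₂ k₂' x y v = kerVec (k₁ - k₂) (k₁' - k₂') x y v := by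
  unfold kerVec; module

lemma inner_kerVec (k k' : ℝ) (x y : S2) {v Z : E3} (hv : inner ℝ (y : E3) v = 0)
    (hZ : inner ℝ (x : E3) Z = 0) : inner ℝ (kerVec k k' x y v) Z = kerForm k k' x y v Z := by
  simp only [kerVec, kerForm, inner_add_left, inner_sub_left, inner_neg_left, real_inner_smul_left,
    inner_sub_right, real_inner_smul_right, hv, hZ]
  ring

lemma inner_kerVec_self (k k' : ℝ) (x y : S2) (v : E3) :
    inner ℝ (x : E3) (kerVec k k' x y v) = 0 := by
  have h1 : inner ℝ (x : E3) (x : E3) = (1 : ℝ) := by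
    rw [real_inner_self_eq_norm_sq, norm_eq_of_mem_sphere, one_pow]
  have h2 : inner ℝ (x : E3) (cross x y) = (0 : ℝ) := by
    simp only [inner_eq_sum, cross_apply_zero, cross_apply_one, cross_apply_two]; ring
  simp only [kerVec, inner_add_right, inner_sub_right, inner_neg_right, real_inner_smul_right, h1,
    h2]
  ring

lemma norm_cross_sq (x y : S2) : ‖cross (x : E3) y‖ ^ 2 = 1 - inner ℝ (x : E3) (y : E3) ^ 2 := by
  have hx := norm_sphere x
  have hy := norm_sphere y
  rw [← real_inner_self_eq_norm_sq]
  simp only [inner_eq_sum, cross_apply_zero, cross_apply_one, cross_apply_two]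
  linear_combination ((y : E3) 0 * (y : E3) 0 + (y : E3) 1 * (y : E3) 1 +
    (y : E3) 2 * (y : E3) 2) * hx + hy

lemma norm_sub_smul_sq (x y : S2) :
    ‖(x : E3) - inner ℝ (x : E3) (y : E3) • (y : E3)‖ ^ 2 = 1 - inner ℝ (x : E3) (y : E3) ^ 2 := by
  rw [norm_sub_sq_real, norm_smul, real_inner_smul_right, norm_eq_of_mem_sphere,
    norm_eq_of_mem_sphere, mul_one, Real.norm_eq_abs, sq_abs]
  ring

lemma norm_inner_smul_le (a v b : E3) : ‖inner ℝ a v • b‖ ≤ ‖a‖ * ‖b‖ * ‖v‖ := by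
  rw [norm_smul]
  calc ‖inner ℝ a v‖ * ‖b‖ ≤ (‖a‖ * ‖v‖) * ‖b‖ := by gcongr; exact norm_inner_le_norm a v
    _ = _ := by ring

/-- The two `κ'` terms are rank one, built from vectors of length `√(1 - t²)`. The four `κ` terms
contribute `1 + 1 + 2 + 2`. -/
lemma norm_kerVec_le (k k' : ℝ) (x y : S2) (v : E3) : ‖kerVec k k' x y v‖ ≤
    (2 * ((1 - inner ℝ (x : E3) (y : E3) ^ 2) * |k'|) + 6 * |k|) * ‖v‖ := by
  have hx : ‖(x : E3)‖ = 1 := norm_eq_of_mem_sphere x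
  have hy : ‖(y : E3)‖ = 1 := norm_eq_of_mem_sphere y
  set t := inner ℝ (x : E3) (y : E3) with ht
  have h1 : ‖inner ℝ (cross (x : E3) y) v • cross (x : E3) y‖ ≤ (1 - t ^ 2) * ‖v‖ := by
    refine (norm_inner_smul_le _ _ _).trans_eq ?_
    rw [← pow_two, norm_cross_sq]
  have h2 : ‖inner ℝ ((x : E3) - t • (y : E3)) v • ((y : E3) - t • (x : E3))‖ ≤
      (1 - t ^ 2) * ‖v‖ := by
    refine (norm_inner_smul_le _ _ _).trans_eq ?_
    have e1 := norm_sub_smul_sq x y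
    have e2 := norm_sub_smul_sq y x
    rw [real_inner_comm, ← ht] at e2
    rw [← ht] at e1
    rw [(sq_eq_sq₀ (norm_nonneg _) (norm_nonneg _)).1 (e2.trans e1.symm), ← pow_two, e1]
  have h3 : ‖t • v‖ ≤ ‖v‖ := by
    rw [norm_smul]
    refine mul_le_of_le_one_left (norm_nonneg _) ?_
    have := norm_inner_le_norm (𝕜 := ℝ) (x : E3) y
    rwa [hx, hy, one_mul] at this
  have h4 : ∀ (z : S2) (u : E3), ‖inner ℝ (z : E3) u • (y : E3)‖ ≤ ‖u‖ := by
    intro z u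
    simpa using norm_inner_smul_le (z : E3) u y
  have h5 : ‖v - inner ℝ (y : E3) v • (y : E3)‖ ≤ 2 * ‖v‖ :=
    (norm_sub_le _ _).trans (by linarith [h4 y v])
  have h6 : ‖inner ℝ (x : E3) (v - inner ℝ (y : E3) v • (y : E3)) • (x : E3)‖ ≤ 2 * ‖v‖ := by
    refine (norm_inner_smul_le _ _ _).trans ?_
    rwa [hx, one_mul, one_mul]
  have h7 := norm_add_le (-(inner ℝ (cross (x : E3) y) v • cross (x : E3) y))
    (inner ℝ ((x : E3) - t • (y : E3)) v • ((y : E3) - t • (x : E3)))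
  rw [norm_neg] at h7
  have h8 := norm_add_le (t • v - inner ℝ (x : E3) v • (y : E3))
    ((v - inner ℝ (y : E3) v • (y : E3)) -
      inner ℝ (x : E3) (v - inner ℝ (y : E3) v • (y : E3)) • (x : E3))
  have h9 := norm_sub_le (t • v) (inner ℝ (x : E3) v • (y : E3))
  have h10 := norm_sub_le (v - inner ℝ (y : E3) v • (y : E3))
    (inner ℝ (x : E3) (v - inner ℝ (y : E3) v • (y : E3)) • (x : E3))
  refine (norm_add_le _ _).trans ?_
  rw [norm_smul, norm_smul, Real.norm_eq_abs, Real.norm_eq_abs, ← ht]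
  calc _ ≤ |k'| * (2 * (1 - t ^ 2) * ‖v‖) + |k| * (6 * ‖v‖) := by
        gcongr
        · linarith
        · linarith [h4 x v]
    _ = _ := by ring

lemma kerVec_congr {k k₁' k₂' : ℝ} {x y : S2} (v : E3)
    (h : 1 - inner ℝ (x : E3) (y : E3) ^ 2 ≠ 0 → k₁' = k₂') :
    kerVec k k₁' x y v = kerVec k k₂' x y v := by
  rw [← sub_eq_zero, kerVec_sub, ← norm_le_zero_iff]
  refine (norm_kerVec_le _ _ _ _ _).trans_eq ?_
  by_cases h0 : 1 - inner ℝ (x : E3) (y : E3) ^ 2 = 0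
  · simp [h0]
  · simp [h h0]

lemma continuous_kerVec :
    Continuous fun p : ℝ × ℝ × E3 × E3 × E3 => kerVec p.1 p.2.1 p.2.2.1 p.2.2.2.1 p.2.2.2.2 := by
  have hc : Continuous fun p : ℝ × ℝ × E3 × E3 × E3 => cross p.2.2.1 p.2.2.2.1 :=
    Continuous.cross (by fun_prop) (by fun_prop)
  unfold kerVec
  fun_prop

/-! ### The function `κ` -/

/-- The integral in the definition of `κ`. -/
def kappaInt (ψ : ℝ → ℝ) (t : ℝ) : ℝ := ∫ s in (-1 : ℝ)..t, (1 - 4 * Real.pi * ψ s)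

lemma legendreP_zero : legendreP 0 = 1 := by simp [legendreP]

lemma kappaInt_one {ψ : ℝ → ℝ} (hψ : Continuous ψ) (h : zonalCoeff ψ 0 = 1) :
    kappaInt ψ 1 = 0 := by
  simp only [zonalCoeff, legendreP_zero, eval_one, mul_one] at h
  rw [kappaInt, intervalIntegral.integral_sub (by simp)
    (Continuous.intervalIntegrable (by fun_prop) _ _), intervalIntegral.integral_const_mul]
  simp
  linarith

lemma kappa_eq {t : ℝ} (ψ : ℝ → ℝ) (ht : t ∈ Set.Ioo (-1 : ℝ) 1) :
    kappa ψ t = kappaInt ψ t / (4 * Real.pi * (1 - t ^ 2)) := by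
  rw [kappa, if_neg ht.2.ne, if_neg ht.1.ne', kappaInt]

lemma hasDerivAt_kappa {ψ : ℝ → ℝ} (hψ : Continuous ψ) {t : ℝ} (ht : t ∈ Set.Ioo (-1 : ℝ) 1) :
    HasDerivAt (kappa ψ) (((1 - 4 * Real.pi * ψ t) + 2 * t * kappaInt ψ t / (1 - t ^ 2)) /
      (4 * Real.pi * (1 - t ^ 2))) t := by
  have h0 : 0 < 1 - t ^ 2 := by nlinarith [ht.1, ht.2]
  have hG : HasDerivAt (kappaInt ψ) (1 - 4 * Real.pi * ψ t) t :=
    (by fun_prop : Continuous fun s => 1 - 4 * Real.pi * ψ s).deriv_integral _ (-1) t ▸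
      ((by fun_prop : Continuous fun s => 1 - 4 * Real.pi * ψ s).integral_hasStrictDerivAt
        (-1) t).hasDerivAt.differentiableAt.hasDerivAt
  have hD : HasDerivAt (fun t : ℝ => 4 * Real.pi * (1 - t ^ 2)) (4 * Real.pi * (-(2 * t))) t := by
    have := ((hasDerivAt_pow 2 t).const_sub 1).const_mul (4 * Real.pi)
    simpa using this
  have hne : 4 * Real.pi * (1 - t ^ 2) ≠ 0 := by positivity
  refine ((hG.div hD hne).congr_deriv ?_).congr_of_eventuallyEq ?_
  · field_simp
    ring
  · filter_upwards [isOpen_Ioo.mem_nhds ht] with s hs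
    exact kappa_eq ψ hs

/-! ### Stability of `κ` and of the matrix kernel. -/

/-- By the normalisation `ψ₁ - ψ₂` has mean zero, so one may integrate from the nearer endpoint, and
`min (1 - t) (1 + t) ≤ 1 - t²`. -/
lemma abs_kappaInt_sub_le {ψ₁ ψ₂ : ℝ → ℝ} (h₁ : Continuous ψ₁) (h₂ : Continuous ψ₂)
    (hn₁ : zonalCoeff ψ₁ 0 = 1) (hn₂ : zonalCoeff ψ₂ 0 = 1) {ε : ℝ}
    (hε : ∀ t ∈ Set.Icc (-1 : ℝ) 1, |ψ₁ t - ψ₂ t| ≤ ε) {t : ℝ} (ht : t ∈ Set.Icc (-1 : ℝ) 1) :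
    |kappaInt ψ₁ t - kappaInt ψ₂ t| ≤ 4 * Real.pi * ε * (1 - t ^ 2) := by
  have hε0 : 0 ≤ ε := (abs_nonneg _).trans (hε t ht)
  have hi : ∀ ψ : ℝ → ℝ, Continuous ψ → ∀ a b,
      IntervalIntegrable (fun s => 1 - 4 * Real.pi * ψ s) volume a b :=
    fun ψ hψ a b => Continuous.intervalIntegrable (by fun_prop) _ _
  have hb : ∀ a b : ℝ, a ∈ Set.Icc (-1 : ℝ) 1 → b ∈ Set.Icc (-1 : ℝ) 1 → a ≤ b →
      |∫ s in a..b, ((1 - 4 * Real.pi * ψ₁ s) - (1 - 4 * Real.pi * ψ₂ s))| ≤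
        4 * Real.pi * ε * (b - a) := by
    intro a b ha hb hab
    have := intervalIntegral.norm_integral_le_of_norm_le_const (a := a) (b := b)
      (f := fun s => (1 - 4 * Real.pi * ψ₁ s) - (1 - 4 * Real.pi * ψ₂ s))
      (C := 4 * Real.pi * ε) (fun s hs => by
        rw [Set.uIoc_of_le hab] at hs
        rw [show (1 - 4 * Real.pi * ψ₁ s) - (1 - 4 * Real.pi * ψ₂ s) =
          -(4 * Real.pi) * (ψ₁ s - ψ₂ s) by ring, Real.norm_eq_abs, abs_mul, abs_neg,
          abs_of_pos (by positivity : 0 < 4 * Real.pi)]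
        gcongr
        exact hε s ⟨ha.1.trans hs.1.le, hs.2.trans hb.2⟩)
    rwa [abs_of_nonneg (sub_nonneg.2 hab)] at this
  have e1 : kappaInt ψ₁ t - kappaInt ψ₂ t =
      ∫ s in (-1 : ℝ)..t, ((1 - 4 * Real.pi * ψ₁ s) - (1 - 4 * Real.pi * ψ₂ s)) := by
    rw [intervalIntegral.integral_sub (hi _ h₁ _ _) (hi _ h₂ _ _)]; rfl
  have e2 : kappaInt ψ₁ t - kappaInt ψ₂ t =
      -∫ s in t..1, ((1 - 4 * Real.pi * ψ₁ s) - (1 - 4 * Real.pi * ψ₂ s)) := by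
    have a1 := intervalIntegral.integral_add_adjacent_intervals (hi _ h₁ (-1) t) (hi _ h₁ t 1)
    have a2 := intervalIntegral.integral_add_adjacent_intervals (hi _ h₂ (-1) t) (hi _ h₂ t 1)
    have b1 := kappaInt_one h₁ hn₁
    have b2 := kappaInt_one h₂ hn₂
    rw [intervalIntegral.integral_sub (hi _ h₁ _ _) (hi _ h₂ _ _)]
    unfold kappaInt at b1 b2 ⊢
    linarith
  have hpi := Real.pi_pos
  have hc : 0 ≤ 4 * Real.pi * ε := by positivity
  rcases le_total 0 t with h | h
  · rw [e2, abs_neg]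
    refine (hb t 1 ht ⟨by norm_num, le_rfl⟩ ht.2).trans ?_
    gcongr
    nlinarith [ht.2]
  · rw [e1]
    refine (hb (-1) t ⟨le_rfl, by norm_num⟩ ht ht.1).trans ?_
    refine mul_le_mul_of_nonneg_left ?_ hc
    nlinarith [ht.1]

/-- In the interior `(1 - t²) κ' = 1/(4π) - ψ + 2tκ`, hence `3ε = ε + 2ε`. At `±1` the weight is
zero, whatever `deriv` returns. -/
lemma kappa_sub_le {ψ₁ ψ₂ : ℝ → ℝ} (h₁ : Continuous ψ₁) (h₂ : Continuous ψ₂)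
    (hn₁ : zonalCoeff ψ₁ 0 = 1) (hn₂ : zonalCoeff ψ₂ 0 = 1) {ε : ℝ}
    (hε : ∀ t ∈ Set.Icc (-1 : ℝ) 1, |ψ₁ t - ψ₂ t| ≤ ε) {t : ℝ} (ht : t ∈ Set.Icc (-1 : ℝ) 1) :
    |kappa ψ₁ t - kappa ψ₂ t| ≤ ε ∧
      (1 - t ^ 2) * |deriv (kappa ψ₁) t - deriv (kappa ψ₂) t| ≤ 3 * ε := by
  have hpi := Real.pi_pos
  have hε0 : 0 ≤ ε := (abs_nonneg _).trans (hε t ht)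
  rcases eq_or_ne t 1 with rfl | ht1
  · refine ⟨?_, by simpa using hε0⟩
    rw [kappa, kappa, if_pos rfl, if_pos rfl, show (4 * Real.pi * ψ₁ 1 - 1) / (8 * Real.pi) -
      (4 * Real.pi * ψ₂ 1 - 1) / (8 * Real.pi) = (ψ₁ 1 - ψ₂ 1) / 2 by field_simp; ring,
      abs_div, abs_two]
    linarith [hε 1 ht]
  rcases eq_or_ne t (-1) with rfl | ht2
  · refine ⟨?_, by simpa using hε0⟩
    rw [kappa, kappa, if_neg ht1, if_neg ht1, if_pos rfl, if_pos rfl,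
      show (1 - 4 * Real.pi * ψ₁ (-1)) / (8 * Real.pi) -
      (1 - 4 * Real.pi * ψ₂ (-1)) / (8 * Real.pi) = -((ψ₁ (-1) - ψ₂ (-1)) / 2) by
        field_simp; ring, abs_neg, abs_div, abs_two]
    linarith [hε (-1) ht]
  have ht' : t ∈ Set.Ioo (-1 : ℝ) 1 := ⟨lt_of_le_of_ne ht.1 ht2.symm, lt_of_le_of_ne ht.2 ht1⟩
  have h0 : 0 < 1 - t ^ 2 := by nlinarith [ht'.1, ht'.2]
  have hG := abs_kappaInt_sub_le h₁ h₂ hn₁ hn₂ hε ht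
  constructor
  · rw [kappa_eq _ ht', kappa_eq _ ht', ← sub_div, abs_div,
      abs_of_pos (by positivity : 0 < 4 * Real.pi * (1 - t ^ 2)), div_le_iff₀ (by positivity)]
    linarith
  · rw [(hasDerivAt_kappa h₁ ht').deriv, (hasDerivAt_kappa h₂ ht').deriv]
    have e : ((1 - 4 * Real.pi * ψ₁ t) + 2 * t * kappaInt ψ₁ t / (1 - t ^ 2)) /
        (4 * Real.pi * (1 - t ^ 2)) - ((1 - 4 * Real.pi * ψ₂ t) +
        2 * t * kappaInt ψ₂ t / (1 - t ^ 2)) / (4 * Real.pi * (1 - t ^ 2)) =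
        (-(ψ₁ t - ψ₂ t) + 2 * t * ((kappaInt ψ₁ t - kappaInt ψ₂ t) /
          (4 * Real.pi * (1 - t ^ 2)))) / (1 - t ^ 2) := by
      field_simp
      ring
    have hq : |(kappaInt ψ₁ t - kappaInt ψ₂ t) / (4 * Real.pi * (1 - t ^ 2))| ≤ ε := by
      rw [abs_div, abs_of_pos (by positivity : 0 < 4 * Real.pi * (1 - t ^ 2)),
        div_le_iff₀ (by positivity)]
      linarith
    have htabs : |t| ≤ 1 := abs_le.2 ht
    rw [e, abs_div, abs_of_pos h0, mul_div_cancel₀ _ h0.ne']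
    refine (abs_add_le _ _).trans ?_
    rw [abs_neg, abs_mul, abs_mul, abs_two]
    have := hε t ht
    have h3 : 2 * |t| * |(kappaInt ψ₁ t - kappaInt ψ₂ t) / (4 * Real.pi * (1 - t ^ 2))| ≤
        2 * 1 * ε := by gcongr
    linarith

lemma inner_mem_Icc (x y : S2) : inner ℝ (x : E3) (y : E3) ∈ Set.Icc (-1 : ℝ) 1 :=
  abs_le.1 (by simpa using norm_inner_le_norm (𝕜 := ℝ) (x : E3) y)

/-- The constant is `12 = 2 · 3 + 6`, from `norm_kerVec_le` and `kappa_sub_le`. -/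
lemma norm_ker_sub_le {ψ₁ ψ₂ : ℝ → ℝ} (h₁ : Continuous ψ₁) (h₂ : Continuous ψ₂)
    (hn₁ : zonalCoeff ψ₁ 0 = 1) (hn₂ : zonalCoeff ψ₂ 0 = 1) {ε : ℝ}
    (hε : ∀ t ∈ Set.Icc (-1 : ℝ) 1, |ψ₁ t - ψ₂ t| ≤ ε) (x y : S2) (v : E3) :
    ‖WithLp.toLp 2 (ker ψ₁ x y *ᵥ v.ofLp) - WithLp.toLp 2 (ker ψ₂ x y *ᵥ v.ofLp)‖ ≤
      12 * ε * ‖v‖ := by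
  obtain ⟨ha, hb⟩ := kappa_sub_le h₁ h₂ hn₁ hn₂ hε (inner_mem_Icc x y)
  rw [ker_mulVec, ker_mulVec, kerVec_sub]
  refine (norm_kerVec_le _ _ _ _ _).trans ?_
  gcongr
  linarith

/-- The kernel depends on the values of `ψ` on `[-1, 1]` only. -/
lemma ker_mulVec_congr {ψ₁ ψ₂ : ℝ → ℝ} (h : ∀ t ∈ Set.Icc (-1 : ℝ) 1, ψ₁ t = ψ₂ t) (x y : S2)
    (v : E3) : WithLp.toLp 2 (ker ψ₁ x y *ᵥ v.ofLp) = WithLp.toLp 2 (ker ψ₂ x y *ᵥ v.ofLp) := by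
  have hk : ∀ t ∈ Set.Icc (-1 : ℝ) 1, kappa ψ₁ t = kappa ψ₂ t := by
    intro t ht
    unfold kappa
    rw [h 1 ⟨by norm_num, le_rfl⟩, h (-1) ⟨le_rfl, by norm_num⟩,
      intervalIntegral.integral_congr (g := fun s => 1 - 4 * Real.pi * ψ₂ s) fun s hs => by
        rw [Set.uIcc_of_le ht.1] at hs
        simp only [h s ⟨hs.1, hs.2.trans ht.2⟩]]
  have ht := inner_mem_Icc x y
  rw [ker_mulVec, ker_mulVec, hk _ ht]
  refine kerVec_congr v fun h0 => Filter.EventuallyEq.deriv_eq ?_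
  have hmem : inner ℝ (x : E3) (y : E3) ∈ Set.Ioo (-1 : ℝ) 1 :=
    ⟨lt_of_le_of_ne ht.1 fun e => h0 (by rw [← e]; norm_num),
      lt_of_le_of_ne ht.2 fun e => h0 (by rw [e]; norm_num)⟩
  filter_upwards [isOpen_Ioo.mem_nhds hmem] with s hs
  exact hk s ⟨hs.1.le, hs.2.le⟩

lemma zonalCoeff_congr {ψ₁ ψ₂ : ℝ → ℝ} (h : ∀ t ∈ Set.Icc (-1 : ℝ) 1, ψ₁ t = ψ₂ t) (l : ℕ) :
    zonalCoeff ψ₁ l = zonalCoeff ψ₂ l := by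
  unfold zonalCoeff
  rw [intervalIntegral.integral_congr (g := fun t => ψ₂ t * (legendreP l).eval t) fun s hs => by
    rw [Set.uIcc_of_le (by norm_num)] at hs
    simp only [h s hs]]

/-- Comparison with the constant `1/(4π)`, for which `κ = 0` and the kernel vanishes. -/
lemma norm_ker_le {ψ : ℝ → ℝ} (hψ : Continuous ψ) (hn : zonalCoeff ψ 0 = 1) :
    ∃ M, ∀ (x y : S2) (v : E3), ‖WithLp.toLp 2 (ker ψ x y *ᵥ v.ofLp)‖ ≤ M * ‖v‖ := by
  obtain ⟨ε, hε⟩ := (isCompact_Icc (a := (-1 : ℝ)) (b := 1)).exists_bound_of_continuousOn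
    (hψ.sub (continuous_const (y := 1 / (4 * Real.pi)))).continuousOn
  refine ⟨12 * ε, fun x y v => ?_⟩
  have hpi := Real.pi_pos
  have h1 : zonalCoeff (fun _ => 1 / (4 * Real.pi)) 0 = 1 := by
    simp [zonalCoeff, legendreP_zero]; field_simp; norm_num
  have h := norm_ker_sub_le hψ continuous_const hn h1 hε x y v
  have h2 : kappa (fun _ => 1 / (4 * Real.pi)) = 0 := by
    ext t
    have : 4 * Real.pi * (1 / (4 * Real.pi)) = 1 := by field_simp
    simp only [kappa, this]
    simp
  have h3 : WithLp.toLp 2 (ker (fun _ => 1 / (4 * Real.pi)) x y *ᵥ v.ofLp) = 0 := by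
    rw [ker_mulVec, h2]
    simp [kerVec]
  rwa [h3, sub_zero] at h

lemma measurable_kappa {ψ : ℝ → ℝ} (hψ : Continuous ψ) : Measurable (kappa ψ) := by
  have h1 : Continuous fun t => ∫ s in (-1 : ℝ)..t, (1 - 4 * Real.pi * ψ s) :=
    intervalIntegral.continuous_primitive
      (fun a b => Continuous.intervalIntegrable (by fun_prop) _ _) _
  unfold kappa
  refine Measurable.ite (measurableSet_eq) measurable_const
    (Measurable.ite (measurableSet_eq) measurable_const ?_)
  exact h1.measurable.div (by fun_prop)

lemma aestronglyMeasurable_ker {ψ : ℝ → ℝ} (hψ : Continuous ψ) {α : Type*} [MeasurableSpace α]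
    {μ : Measure α} {a b : α → S2} (ha : Measurable a) (hb : Measurable b) {f : α → E3}
    (hf : AEStronglyMeasurable f μ) :
    AEStronglyMeasurable (fun p => WithLp.toLp 2 (ker ψ (a p) (b p) *ᵥ (f p).ofLp)) μ := by
  simp only [ker_mulVec]
  have ht : Measurable fun p => inner ℝ (a p : E3) (b p : E3) :=
    (measurable_subtype_coe.comp ha).inner (measurable_subtype_coe.comp hb)
  exact continuous_kerVec.comp_aestronglyMeasurable
    (((measurable_kappa hψ).comp ht).aestronglyMeasurable.prodMk
      (((measurable_deriv _).comp ht).aestronglyMeasurable.prodMk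
        ((measurable_subtype_coe.comp ha).aestronglyMeasurable.prodMk
          ((measurable_subtype_coe.comp hb).aestronglyMeasurable.prodMk hf))))

/-! ### The vector Funk–Hecke formula -/

lemma eval_legendreOp_one (h : ℝ[X]) : (legendreOp h).eval 1 = -2 * (derivative h).eval 1 := by
  simp [legendreOp_eq]

lemma eval_legendreOp_neg_one (h : ℝ[X]) :
    (legendreOp h).eval (-1) = 2 * (derivative h).eval (-1) := by
  simp [legendreOp_eq]

/-- Here `1 - 4πψ = 4π ((1 - t²) h')'`, so the primitive from `-1` carries exactly the factor by
which `κ` divides. -/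
lemma kappa_kernelPoly (h : ℝ[X]) (t : ℝ) :
    kappa (fun s => (kernelPoly h).eval s) t = (derivative h).eval t := by
  have hpi := Real.pi_pos
  have e : ∀ s, (kernelPoly h).eval s = 1 / (4 * Real.pi) - (legendreOp h).eval s := by
    intro s; simp [kernelPoly]
  unfold kappa
  simp only [e]
  split_ifs with h1 h2
  · rw [h1, eval_legendreOp_one]
    field_simp
    ring
  · rw [h2, eval_legendreOp_neg_one]
    field_simp
    ring
  · have h3 : ∀ s, 1 - 4 * Real.pi * (1 / (4 * Real.pi) - (legendreOp h).eval s) =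
        4 * Real.pi * (legendreOp h).eval s := by intro s; field_simp; ring
    have h4 : 1 - t ^ 2 ≠ 0 := by
      have : (1 - t) * (1 + t) ≠ 0 := mul_ne_zero (sub_ne_zero.2 (Ne.symm h1))
        (fun h5 => h2 (by linarith))
      intro h5; apply this; linarith
    simp only [h3]
    rw [intervalIntegral.integral_const_mul, legendreOp, integral_eval_derivative]
    simp
    field_simp

lemma inner_ker_kernelPoly (h : ℝ[X]) (x y : S2) {v Z : E3} (hv : inner ℝ (y : E3) v = 0)
    (hZ : inner ℝ (x : E3) Z = 0) :
    inner ℝ (WithLp.toLp 2 (ker (fun s => (kernelPoly h).eval s) x y *ᵥ v.ofLp)) Z =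
      kerForm ((derivative h).eval (inner ℝ (x : E3) (y : E3)))
        ((derivative (derivative h)).eval (inner ℝ (x : E3) (y : E3))) x y v Z := by
  rw [ker_mulVec, funext (kappa_kernelPoly h), Polynomial.deriv, inner_kerVec _ _ x y hv hZ]

lemma exists_derivative_eq (p : ℝ[X]) : ∃ q : ℝ[X], derivative q = p := by
  induction p using Polynomial.induction_on' with
  | add p q hp hq =>
    obtain ⟨a, rfl⟩ := hp
    obtain ⟨b, rfl⟩ := hq
    exact ⟨a + b, by simp⟩
  | monomial n a =>
    refine ⟨monomial (n + 1) (a / (n + 1)), ?_⟩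
    rw [derivative_monomial]
    have : (n : ℝ) + 1 ≠ 0 := by positivity
    simp [this]

/-- To solve `((1 - X²) h')' = 1/(4π) - p`: the right side has mean zero by the normalisation, so a
primitive `G` agrees at `±1` and `G - G(1)` is divisible by `X² - 1`. -/
lemma exists_kernelPoly {p : ℝ[X]} (hp : legendreFunctional 0 p = 1) : ∃ h, p = kernelPoly h := by
  have hpi := Real.pi_pos
  obtain ⟨G, hG⟩ := exists_derivative_eq (C (1 / (4 * Real.pi)) - p)
  have h1 : G.eval 1 = G.eval (-1) := by
    have h := integral_eval_derivative G (-1) 1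
    rw [hG] at h
    simp only [eval_sub, eval_C] at h
    rw [intervalIntegral.integral_sub (by simp) (Continuous.intervalIntegrable (by fun_prop) _ _),
      intervalIntegral.integral_const] at h
    simp only [legendreFunctional_apply, zonalCoeff, legendreP_zero, eval_one, mul_one] at hp
    have h2 : ∫ t in (-1 : ℝ)..1, p.eval t = 1 / (2 * Real.pi) := by
      rw [eq_div_iff (by positivity)]; linarith
    rw [h2, smul_eq_mul] at h
    have h3 : (1 - -1) * (1 / (4 * Real.pi)) - 1 / (2 * Real.pi) = 0 := by field_simp; norm_num
    linarith
  have hcop : IsCoprime (X - C (1 : ℝ)) (X - C (-1 : ℝ)) :=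
    isCoprime_X_sub_C_of_isUnit_sub (by norm_num)
  obtain ⟨q, hq⟩ : (X - C (1 : ℝ)) * (X - C (-1 : ℝ)) ∣ G - C (G.eval 1) :=
    hcop.mul_dvd (by rw [dvd_iff_isRoot]; simp) (by rw [dvd_iff_isRoot]; simp [h1])
  obtain ⟨h, hh⟩ := exists_derivative_eq (-q)
  refine ⟨h, ?_⟩
  have h3 : (1 - X ^ 2) * derivative h = G - C (G.eval 1) := by
    rw [hh, hq]; simp; ring
  rw [kernelPoly, legendreOp, h3, derivative_sub, derivative_C, hG]
  ring

/-- A continuous tangential field that satisfies the Funk–Hecke formula of degree `l` for polynomial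
kernels. -/
structure IsConvEigenfield (l : ℕ) (Z : S2 → E3) : Prop where
  continuous : Continuous Z
  tangent : ∀ x : S2, inner ℝ (x : E3) (Z x) = 0
  integral_eq : ∀ (h : ℝ[X]) (y : S2) (v : E3), inner ℝ (y : E3) v = 0 →
    ∫ x : S2, kerForm ((derivative h).eval (inner ℝ (x : E3) (y : E3)))
      ((derivative (derivative h)).eval (inner ℝ (x : E3) (y : E3))) x y v (Z x) ∂surf =
      legendreFunctional l (kernelPoly h) * inner ℝ v (Z y)

lemma IsConvEigenfield.const_smul {l : ℕ} {Z : S2 → E3} (hZ : IsConvEigenfield l Z) (c : ℝ) :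
    IsConvEigenfield l fun x => c • Z x where
  continuous := hZ.continuous.const_smul c
  tangent x := by rw [real_inner_smul_right, hZ.tangent, mul_zero]
  integral_eq h y v hv := by
    have e : ∀ k k' : ℝ, ∀ x y v z : E3, kerForm k k' x y v (c • z) = c * kerForm k k' x y v z := by
      intro k k' x y v z
      simp only [kerForm, real_inner_smul_right]
      ring
    simp only [e, integral_const_mul, hZ.integral_eq h y v hv, real_inner_smul_right]
    ring

lemma isConvEigenfield_vecY {l : ℕ} (hl : l ≠ 0) (k : Fin (2 * l + 1)) :
    IsConvEigenfield l (vecY l k) := by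
  refine IsConvEigenfield.const_smul (Z := surfCurl (Y l k)) ?_ _
  rw [Y_eq_evalAt]
  exact ⟨continuous_surfCurl _, inner_surfCurl _, fun h y v hv =>
    integral_kerForm_surfCurl hl (isEigen_harmPoly l k) h y hv⟩

lemma isConvEigenfield_vecZ {l : ℕ} (hl : l ≠ 0) (k : Fin (2 * l + 1)) :
    IsConvEigenfield l (vecZ l k) := by
  refine IsConvEigenfield.const_smul (Z := surfGrad (Y l k)) ?_ _
  rw [Y_eq_evalAt]
  exact ⟨continuous_surfGrad _, inner_surfGrad _, fun h y v hv =>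
    integral_kerForm_surfGrad hl (isEigen_harmPoly l k) h y hv⟩

/-! ### From polynomial to continuous kernels. -/

lemma abs_zonalCoeff_sub_le {ψ₁ ψ₂ : ℝ → ℝ} (h₁ : Continuous ψ₁) (h₂ : Continuous ψ₂) {l : ℕ}
    {ε B : ℝ} (hε : ∀ t ∈ Set.Icc (-1 : ℝ) 1, |ψ₁ t - ψ₂ t| ≤ ε)
    (hB : ∀ t ∈ Set.Icc (-1 : ℝ) 1, |(legendreP l).eval t| ≤ B) :
    |zonalCoeff ψ₁ l - zonalCoeff ψ₂ l| ≤ 4 * Real.pi * B * ε := by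
  have hpi := Real.pi_pos
  rw [zonalCoeff, zonalCoeff, ← mul_sub, ← intervalIntegral.integral_sub
    (Continuous.intervalIntegrable (by fun_prop) _ _)
    (Continuous.intervalIntegrable (by fun_prop) _ _), abs_mul,
    abs_of_pos (by positivity : 0 < 2 * Real.pi)]
  have h := intervalIntegral.norm_integral_le_of_norm_le_const (a := (-1 : ℝ)) (b := 1)
    (f := fun t => ψ₁ t * (legendreP l).eval t - ψ₂ t * (legendreP l).eval t) (C := ε * B)
    (fun t ht => by
      rw [Set.uIoc_of_le (by norm_num)] at ht
      have ht' : t ∈ Set.Icc (-1 : ℝ) 1 := ⟨ht.1.le, ht.2⟩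
      rw [← sub_mul, Real.norm_eq_abs, abs_mul]
      exact mul_le_mul (hε t ht') (hB t ht') (abs_nonneg _) ((abs_nonneg _).trans (hε t ht')))
  rw [Real.norm_eq_abs] at h
  calc _ ≤ 2 * Real.pi * (ε * B * |1 - -1|) := by gcongr
    _ = _ := by norm_num; ring

lemma integrable_inner_ker {ψ : ℝ → ℝ} (hψ : Continuous ψ) (hn : zonalCoeff ψ 0 = 1)
    {Z : S2 → E3} (hZ : Continuous Z) (y : S2) (v : E3) :
    Integrable (fun x : S2 => inner ℝ (WithLp.toLp 2 (ker ψ x y *ᵥ v.ofLp)) (Z x)) surf := by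
  obtain ⟨M, hM⟩ := norm_ker_le hψ hn
  refine Integrable.mono' (g := fun x => M * ‖v‖ * ‖Z x‖) (integrable_surf (by fun_prop)) ?_
    (.of_forall fun x => ?_)
  · exact (aestronglyMeasurable_ker hψ measurable_id measurable_const
      (f := fun _ => v) aestronglyMeasurable_const).inner hZ.aestronglyMeasurable
  · refine (norm_inner_le_norm _ _).trans ?_
    gcongr
    exact hM x y v

/-- A normalised continuous kernel is a uniform limit of normalised polynomials. -/
lemma exists_normalised_polynomial_near {ψ : ℝ → ℝ} (hψ : Continuous ψ) (hn : zonalCoeff ψ 0 = 1)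
    {ε : ℝ} (hε : 0 < ε) : ∃ p : ℝ[X], legendreFunctional 0 p = 1 ∧
      ∀ t ∈ Set.Icc (-1 : ℝ) 1, |ψ t - p.eval t| ≤ ε := by
  have hpi := Real.pi_pos
  obtain ⟨q, hq⟩ := exists_polynomial_near_of_continuousOn (-1) 1 ψ hψ.continuousOn (ε / 2)
    (half_pos hε)
  have hq' : ∀ t ∈ Set.Icc (-1 : ℝ) 1, |ψ t - q.eval t| ≤ ε / 2 := fun t ht => by
    rw [abs_sub_comm]; exact (hq t ht).le
  have h1 := abs_zonalCoeff_sub_le hψ (by fun_prop : Continuous fun t => q.eval t) (l := 0)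
    (B := 1) hq' (fun t _ => by simp [legendreP_zero])
  rw [hn, ← legendreFunctional_apply] at h1
  have h2 : legendreFunctional 0 1 = 4 * Real.pi := by
    simp [legendreFunctional_apply, zonalCoeff, legendreP_zero]; ring
  -- A constant shift restores the normalisation. The defect is at most `4π · ε/2`, so the shift
  -- costs at most the other `ε/2`.
  refine ⟨q + C ((1 - legendreFunctional 0 q) / (4 * Real.pi)), ?_, fun t ht => ?_⟩
  · rw [map_add, ← mul_one (C _), ← smul_eq_C_mul, map_smul, h2, smul_eq_mul]
    field_simp
    ring
  · have h3 : |(1 - legendreFunctional 0 q) / (4 * Real.pi)| ≤ ε / 2 := by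
      rw [abs_div, abs_of_pos (by positivity : 0 < 4 * Real.pi), div_le_iff₀ (by positivity)]
      linarith
    rw [eval_add, eval_C, ← sub_sub]
    exact (abs_sub _ _).trans (by linarith [hq' t ht])

/-- The Funk–Hecke formula for the kernel of a continuous `ψ`. -/
lemma IsConvEigenfield.integral_ker {l : ℕ} {Z : S2 → E3} (hZ : IsConvEigenfield l Z) {ψ : ℝ → ℝ}
    (hψ : Continuous ψ) (hn : zonalCoeff ψ 0 = 1) (y : S2) {v : E3}
    (hv : inner ℝ (y : E3) v = 0) :
    ∫ x : S2, inner ℝ (WithLp.toLp 2 (ker ψ x y *ᵥ v.ofLp)) (Z x) ∂surf =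
      zonalCoeff ψ l * inner ℝ v (Z y) := by
  obtain ⟨B, hB⟩ := (isCompact_Icc (a := (-1 : ℝ)) (b := 1)).exists_bound_of_continuousOn
    (legendreP l).continuous.continuousOn
  set K : ℝ := 12 * ‖v‖ * (∫ x : S2, ‖Z x‖ ∂surf) + 4 * Real.pi * B * |inner ℝ v (Z y)| with hK
  -- Both sides are Lipschitz in `ψ` for the uniform norm and agree for polynomials; `K` is the sum
  -- of the two Lipschitz constants.
  have key : ∀ ε > 0, |∫ x : S2, inner ℝ (WithLp.toLp 2 (ker ψ x y *ᵥ v.ofLp)) (Z x) ∂surf -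
      zonalCoeff ψ l * inner ℝ v (Z y)| ≤ K * ε := by
    intro ε hε
    obtain ⟨p, hp, hpε⟩ := exists_normalised_polynomial_near hψ hn hε
    obtain ⟨h, rfl⟩ := exists_kernelPoly hp
    have hc : Continuous fun s => (kernelPoly h).eval s := by fun_prop
    have h1 : ∫ x : S2, inner ℝ (WithLp.toLp 2
        (ker (fun s => (kernelPoly h).eval s) x y *ᵥ v.ofLp)) (Z x) ∂surf =
        zonalCoeff (fun s => (kernelPoly h).eval s) l * inner ℝ v (Z y) := by
      simp only [inner_ker_kernelPoly h _ y hv (hZ.tangent _), hZ.integral_eq h y v hv,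
        legendreFunctional_apply]
    have h2 : |∫ x : S2, inner ℝ (WithLp.toLp 2 (ker ψ x y *ᵥ v.ofLp)) (Z x) ∂surf -
        ∫ x : S2, inner ℝ (WithLp.toLp 2
          (ker (fun s => (kernelPoly h).eval s) x y *ᵥ v.ofLp)) (Z x) ∂surf| ≤
        12 * ε * ‖v‖ * ∫ x : S2, ‖Z x‖ ∂surf := by
      rw [← integral_sub (integrable_inner_ker hψ hn hZ.continuous y v)
        (integrable_inner_ker hc hp hZ.continuous y v), ← integral_const_mul, ← Real.norm_eq_abs]
      refine norm_integral_le_of_norm_le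
        (integrable_surf (by have := hZ.continuous; fun_prop)) (.of_forall fun x => ?_)
      rw [← inner_sub_left]
      refine (norm_inner_le_norm _ _).trans ?_
      gcongr
      exact norm_ker_sub_le hψ hc hn hp hpε x y v
    have h3 := abs_zonalCoeff_sub_le hψ hc hpε hB
    rw [h1] at h2
    have h4 : |zonalCoeff (fun s => (kernelPoly h).eval s) l * inner ℝ v (Z y) -
        zonalCoeff ψ l * inner ℝ v (Z y)| ≤ 4 * Real.pi * B * ε * |inner ℝ v (Z y)| := by
      rw [← sub_mul, abs_mul, abs_sub_comm]
      gcongr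
    refine (abs_sub_le _ _ _).trans ((add_le_add h2 h4).trans_eq ?_)
    rw [hK]; ring
  rw [← sub_eq_zero, ← abs_nonpos_iff]
  have hlim : Filter.Tendsto (fun ε : ℝ => K * ε) (nhdsWithin 0 (Set.Ioi 0)) (nhds 0) := by
    have : Filter.Tendsto (fun ε : ℝ => K * ε) (nhds 0) (nhds (K * 0)) :=
      (continuous_const_mul K).tendsto 0
    rw [mul_zero] at this
    exact this.mono_left nhdsWithin_le_nhds
  refine ge_of_tendsto hlim ?_
  filter_upwards [self_mem_nhdsWithin] with ε hε
  exact key ε hε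

/-! ### The convolution operator -/

lemma IsTangentL2.integrable {f : S2 → E3} (hf : IsTangentL2 f) : Integrable f surf :=
  hf.2.integrable (by norm_num)

lemma integrable_convIntegrand {ψ : ℝ → ℝ} (hψ : Continuous ψ) (hn : zonalCoeff ψ 0 = 1)
    {f : S2 → E3} (hf : Integrable f surf) (x : S2) : Integrable (convIntegrand ψ f x) surf := by
  obtain ⟨M, hM⟩ := norm_ker_le hψ hn
  refine Integrable.mono' (g := fun y => M * ‖f y‖) (hf.norm.const_mul M) ?_
    (.of_forall fun y => hM x y (f y))
  exact aestronglyMeasurable_ker hψ measurable_const measurable_id hf.1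

lemma aestronglyMeasurable_uncurry_convIntegrand {ψ : ℝ → ℝ} (hψ : Continuous ψ) {f : S2 → E3}
    (hf : Integrable f surf) :
    AEStronglyMeasurable (fun p : S2 × S2 => convIntegrand ψ f p.1 p.2) (surf.prod surf) :=
  aestronglyMeasurable_ker hψ measurable_fst measurable_snd hf.1.comp_snd

lemma isTangentL2_conv {ψ : ℝ → ℝ} (hψ : Continuous ψ) (hn : zonalCoeff ψ 0 = 1)
    {f : S2 → E3} (hf : Integrable f surf) : IsTangentL2 (conv ψ f) := by
  constructor
  · intro x
    rw [conv, ← integral_inner (integrable_convIntegrand hψ hn hf x)]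
    simp only [convIntegrand, ker_mulVec, inner_kerVec_self, integral_zero]
  · obtain ⟨M, hM⟩ := norm_ker_le hψ hn
    refine MemLp.of_bound
      (aestronglyMeasurable_uncurry_convIntegrand hψ hf).integral_prod_right' (M * ∫ y, ‖f y‖ ∂surf)
      (.of_forall fun x => ?_)
    rw [← integral_const_mul]
    exact norm_integral_le_of_norm_le (hf.norm.const_mul M) (.of_forall fun y => hM x y (f y))

/-- After Fubini the inner integral runs over the first variable of the kernel with `v = f y` fixed,
which is the form of `integral_ker`; tangency of `f` supplies its hypothesis on `v`. -/
lemma IsConvEigenfield.integral_conv {l : ℕ} {Z : S2 → E3} (hZ : IsConvEigenfield l Z)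
    {ψ : ℝ → ℝ} (hψ : Continuous ψ) (hn : zonalCoeff ψ 0 = 1) {f : S2 → E3}
    (hf : IsTangentL2 f) :
    ∫ x, inner ℝ (conv ψ f x) (Z x) ∂surf = zonalCoeff ψ l * ∫ y, inner ℝ (f y) (Z y) ∂surf := by
  have hi := hf.integrable
  obtain ⟨M, hM⟩ := norm_ker_le hψ hn
  have h1 : ∀ x, inner ℝ (conv ψ f x) (Z x) =
      ∫ y, inner ℝ (convIntegrand ψ f x y) (Z x) ∂surf := by
    intro x
    rw [conv, real_inner_comm, ← integral_inner (integrable_convIntegrand hψ hn hi x)]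
    simp only [real_inner_comm]
  have h2 : Integrable (Function.uncurry fun x y => inner ℝ (convIntegrand ψ f x y) (Z x))
      (surf.prod surf) := by
    have hZi : Integrable (fun x => ‖Z x‖) surf :=
      integrable_surf (by have := hZ.continuous; fun_prop)
    refine ((hZi.mul_prod hi.norm).const_mul M).mono' ?_ (.of_forall fun p => ?_)
    · exact (aestronglyMeasurable_uncurry_convIntegrand hψ hi).inner
        (hZ.continuous.comp continuous_fst).aestronglyMeasurable
    · refine (norm_inner_le_norm _ _).trans ?_
      calc _ ≤ (M * ‖f p.2‖) * ‖Z p.1‖ := by gcongr; exact hM p.1 p.2 (f p.2)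
        _ = _ := by ring
  simp only [h1]
  rw [integral_integral_swap h2, ← integral_const_mul]
  congr 1
  ext y
  exact hZ.integral_ker hψ hn y (hf.1 y)

/-! ### The multiplier estimate -/

/-- The constant extension of a function on `[-1, 1]`. -/
def iccExt (ψ : ℝ → ℝ) : ℝ → ℝ :=
  Set.IccExtend (by norm_num : (-1 : ℝ) ≤ 1) (Set.domRestrict (Set.Icc (-1 : ℝ) 1) ψ)

lemma iccExt_eq (ψ : ℝ → ℝ) {t : ℝ} (ht : t ∈ Set.Icc (-1 : ℝ) 1) : ψ t = iccExt ψ t := by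
  rw [iccExt, Set.IccExtend_of_mem _ _ ht, Set.domRestrict_apply]

lemma continuous_iccExt {ψ : ℝ → ℝ} (hψ : ContinuousOn ψ (Set.Icc (-1) 1)) :
    Continuous (iccExt ψ) :=
  (continuousOn_iff_continuous_domRestrict.1 hψ).Icc_extend'

lemma convIntegrand_iccExt (ψ : ℝ → ℝ) (f : S2 → E3) :
    convIntegrand ψ f = convIntegrand (iccExt ψ) f := by
  ext1 x; ext1 y
  exact ker_mulVec_congr (fun t ht => iccExt_eq ψ ht) x y (f y)

lemma conv_iccExt (ψ : ℝ → ℝ) (f : S2 → E3) : conv ψ f = conv (iccExt ψ) f := by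
  unfold conv
  rw [convIntegrand_iccExt]

lemma IsZonalFamily.continuousOn_section {ψ : ℝ → ℝ → ℝ} (hψ : IsZonalFamily ψ) {ρ : ℝ}
    (hρ : ρ ∈ Set.Ioo (0 : ℝ) 1) : ContinuousOn (ψ ρ) (Set.Icc (-1) 1) :=
  hψ.continuousOn.comp (f := fun t => (ρ, t)) (by fun_prop) fun _ ht => ⟨hρ, ht⟩

lemma abs_zonalCoeff_le {ψ : ℝ → ℝ} (hψ : ContinuousOn ψ (Set.Icc (-1) 1)) {l : ℕ} {M B : ℝ}
    (hM : ∀ t ∈ Set.Icc (-1 : ℝ) 1, |ψ t| ≤ M)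
    (hB : ∀ t ∈ Set.Icc (-1 : ℝ) 1, |(legendreP l).eval t| ≤ B) :
    |zonalCoeff ψ l| ≤ 4 * Real.pi * B * M := by
  have h := abs_zonalCoeff_sub_le (continuous_iccExt hψ) (continuous_const (y := (0 : ℝ)))
    (ε := M) (fun t ht => by rw [sub_zero, ← iccExt_eq ψ ht]; exact hM t ht) hB
  have h0 : zonalCoeff (fun _ => 0) l = 0 := by simp [zonalCoeff]
  rwa [h0, sub_zero, ← zonalCoeff_congr (fun t ht => iccExt_eq ψ ht)] at h

/-- Covers low degrees for `ρ ≥ ρ₀`, where the approximation condition says nothing: joint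
continuity bounds `ψ` on a compact set. -/
lemma IsZonalFamily.exists_bound {ψ : ℝ → ℝ → ℝ} (hψ : IsZonalFamily ψ) {ρ₀ : ℝ} (hρ₀ : 0 < ρ₀)
    (L : ℕ) : ∃ B, 0 ≤ B ∧ ∀ ρ ∈ Set.Icc ρ₀ (1 / 2), ∀ l ≤ L, |1 - zonalCoeff (ψ ρ) l| ≤ B := by
  have hsub : Set.Icc ρ₀ (1 / 2) ⊆ Set.Ioo (0 : ℝ) 1 := fun ρ hρ =>
    ⟨hρ₀.trans_le hρ.1, hρ.2.trans_lt (by norm_num)⟩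
  obtain ⟨M, hM⟩ := ((isCompact_Icc (a := ρ₀) (b := 1 / 2)).prod
    (isCompact_Icc (a := (-1 : ℝ)) (b := 1))).exists_bound_of_continuousOn
    (hψ.continuousOn.mono (Set.prod_mono hsub le_rfl))
  have hP : ∀ l : ℕ, ∃ b, ∀ t ∈ Set.Icc (-1 : ℝ) 1, ‖(legendreP l).eval t‖ ≤ b := fun l =>
    isCompact_Icc.exists_bound_of_continuousOn (legendreP l).continuous.continuousOn
  choose b hb using hP
  refine ⟨∑ l ∈ Finset.range (L + 1), (1 + |4 * Real.pi * b l * M|),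
    Finset.sum_nonneg fun l _ => by positivity, fun ρ hρ l hl => ?_⟩
  have h1 : |zonalCoeff (ψ ρ) l| ≤ 4 * Real.pi * b l * M :=
    abs_zonalCoeff_le (hψ.continuousOn_section (hsub hρ)) (fun t ht => hM (ρ, t) ⟨hρ, ht⟩) (hb l)
  have h2 : 1 + |4 * Real.pi * b l * M| ≤
      ∑ l ∈ Finset.range (L + 1), (1 + |4 * Real.pi * b l * M|) :=
    Finset.single_le_sum (f := fun l => 1 + |4 * Real.pi * b l * M|)
      (fun l _ => by positivity) (Finset.mem_range.2 (by omega))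
  refine le_trans ?_ h2
  refine (abs_sub _ _).trans ?_
  rw [abs_one]
  exact add_le_add le_rfl (h1.trans (le_abs_self _))

lemma one_add_eigenval_pos (l : ℕ) : 0 < 1 + eigenval l := by unfold eigenval; positivity

lemma exists_multiplier_bound {ψ : ℝ → ℝ → ℝ} (hψ : IsZonalFamily ψ) {m s : ℝ}
    (hm : ApproxOrder ψ m) (hs : 0 ≤ s) (hsm : s ≤ m) :
    ∃ C : ℝ, 0 < C ∧ ∀ ρ : ℝ, 0 < ρ → ρ < 1 → ∀ l : ℕ, 1 ≤ l →
      |1 - zonalCoeff (ψ ρ) l| ≤ C * (ρ * √(1 + eigenval l)) ^ s := by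
  obtain ⟨-, ρ₀, c₁, c₂, hρ₀, -, hc₁, hc₂, h1, h2⟩ := hm
  obtain ⟨B, hB, h3⟩ := hψ.exists_bound hρ₀ ⌊ρ₀⁻¹ - 1⌋₊
  -- One summand for each case: degrees above the cut-off; degrees below it with `ρ < ρ₀`; degrees
  -- below it with `ρ ≥ ρ₀`.
  refine ⟨(1 + c₂) * 2 ^ s + c₁ + B * (ρ₀ ^ s)⁻¹, by positivity, fun ρ hρ hρ1 l hl => ?_⟩
  have hl1 : (1 : ℝ) ≤ l := by exact_mod_cast hl
  have hinv : 0 ≤ ρ⁻¹ - 1 := sub_nonneg.2 ((one_le_inv₀ hρ).2 hρ1.le)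
  have hpos : 0 ≤ (ρ * √(1 + eigenval l)) ^ s := by positivity
  have hA : 0 ≤ (1 + c₂) * 2 ^ s := by positivity
  have hC : 0 ≤ B * (ρ₀ ^ s)⁻¹ := by positivity
  have hsqrt : (l : ℝ) ≤ √(1 + eigenval l) := Real.le_sqrt_of_sq_le (by unfold eigenval; nlinarith)
  rcases lt_or_ge ⌊ρ⁻¹ - 1⌋₊ l with hlt | hle
  -- Above the cut-off `(l + 1) ρ > 1`, and `l + 1 ≤ 2l ≤ 2 √(1 + λ_l)` since `l ≥ 1`.
  · have h4 : 1 ≤ 2 * (ρ * √(1 + eigenval l)) := by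
      have h5 := Nat.lt_of_floor_lt hlt
      have h6 : 1 < (l + 1) * ρ := by
        have := mul_lt_mul_of_pos_right h5 hρ
        rw [sub_mul, inv_mul_cancel₀ hρ.ne'] at this
        linarith
      nlinarith
    have h5 : 1 ≤ 2 ^ s * (ρ * √(1 + eigenval l)) ^ s := by
      rw [← Real.mul_rpow (by norm_num) (by positivity)]
      exact Real.one_le_rpow h4 hs
    calc |1 - zonalCoeff (ψ ρ) l| ≤ 1 + c₂ := by
          refine (abs_sub _ _).trans ?_
          rw [abs_one]
          gcongr
          exact h2 ρ hρ hρ1 l hlt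
      _ ≤ (1 + c₂) * (2 ^ s * (ρ * √(1 + eigenval l)) ^ s) :=
          le_mul_of_one_le_right (by positivity) h5
      _ = (1 + c₂) * 2 ^ s * (ρ * √(1 + eigenval l)) ^ s := by ring
      _ ≤ _ := by gcongr; linarith
  · have h4 : (l : ℝ) ≤ ρ⁻¹ - 1 := (Nat.le_floor_iff hinv).1 hle
    have h5 : l * ρ ≤ 1 - ρ := by
      have := mul_le_mul_of_nonneg_right h4 hρ.le
      rwa [sub_mul, inv_mul_cancel₀ hρ.ne', one_mul] at this
    rcases lt_or_ge ρ ρ₀ with hρlt | hρge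
    · calc |1 - zonalCoeff (ψ ρ) l| ≤ c₁ * (l * ρ) ^ m := h1 ρ hρ hρlt l hle
        _ ≤ c₁ * (l * ρ) ^ s := by
          gcongr ?_ * ?_
          -- Below the cut-off `l ρ ≤ 1`, so lowering the exponent from `m` to `s` increases the
          -- power.
          exact Real.rpow_le_rpow_of_exponent_ge (by positivity) (by linarith) hsm
        _ ≤ c₁ * (ρ * √(1 + eigenval l)) ^ s := by
          rw [mul_comm (l : ℝ)]
          gcongr
        _ ≤ _ := by gcongr; linarith
    -- From `l ≥ 1` and `l ρ ≤ 1 - ρ`: this keeps `ρ` away from `1`, where continuity of the family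
    -- gives no bound.
    · have h6 : ρ ≤ 1 / 2 := by nlinarith
      have h7 : l ≤ ⌊ρ₀⁻¹ - 1⌋₊ := hle.trans (Nat.floor_mono (by gcongr))
      calc |1 - zonalCoeff (ψ ρ) l| ≤ B := h3 ρ ⟨hρge, h6⟩ l h7
        _ = B * (ρ₀ ^ s)⁻¹ * ρ₀ ^ s := by field_simp
        _ ≤ B * (ρ₀ ^ s)⁻¹ * (ρ * √(1 + eigenval l)) ^ s := by
          gcongr
          nlinarith
        _ ≤ _ := by gcongr; linarith

/-! ### The approximation estimate -/

lemma integrable_inner_of_continuous {f Z : S2 → E3} (hf : Integrable f surf)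
    (hZ : Continuous Z) : Integrable (fun x => inner ℝ (f x) (Z x)) surf := by
  obtain ⟨B, hB⟩ := (isCompact_univ (X := S2)).exists_bound_of_continuousOn hZ.continuousOn
  refine (hf.norm.mul_const B).mono' (hf.1.inner hZ.aestronglyMeasurable) (.of_forall fun x => ?_)
  refine (norm_inner_le_norm _ _).trans ?_
  gcongr
  exact hB x trivial

lemma IsConvEigenfield.integral_sub_conv {l : ℕ} {Z : S2 → E3} (hZ : IsConvEigenfield l Z)
    {ψ : ℝ → ℝ} (hψ : Continuous ψ) (hn : zonalCoeff ψ 0 = 1) {f : S2 → E3}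
    (hf : IsTangentL2 f) :
    ∫ x, inner ℝ (f x - conv ψ f x) (Z x) ∂surf =
      (1 - zonalCoeff ψ l) * ∫ y, inner ℝ (f y) (Z y) ∂surf := by
  simp only [inner_sub_left]
  rw [integral_sub (integrable_inner_of_continuous hf.integrable hZ.continuous)
    (integrable_inner_of_continuous (isTangentL2_conv hψ hn hf.integrable).integrable
      hZ.continuous), hZ.integral_conv hψ hn hf]
  ring

lemma sobolevTerm_sub_conv_le {ψ : ℝ → ℝ} (hψ : Continuous ψ) (hn : zonalCoeff ψ 0 = 1)
    {f : S2 → E3} (hf : IsTangentL2 f) {τ σ C ρ : ℝ} (hρ : 0 < ρ) {l : ℕ} (hl : l ≠ 0)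
    (h : |1 - zonalCoeff ψ l| ≤ C * (ρ * √(1 + eigenval l)) ^ (σ - τ)) :
    sobolevTerm τ (fun x => f x - conv ψ f x) l ≤ (C * ρ ^ (σ - τ)) ^ 2 * sobolevTerm σ f l := by
  have hw := one_add_eigenval_pos l
  have hsq : (1 + eigenval l) ^ τ * |1 - zonalCoeff ψ l| ^ 2 ≤
      (C * ρ ^ (σ - τ)) ^ 2 * (1 + eigenval l) ^ σ := by
    have h1 : (√(1 + eigenval l) ^ (σ - τ)) ^ 2 * (1 + eigenval l) ^ τ = (1 + eigenval l) ^ σ := by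
      rw [Real.rpow_pow_comm (Real.sqrt_nonneg _), Real.sq_sqrt hw.le, ← Real.rpow_add hw,
        sub_add_cancel]
    calc (1 + eigenval l) ^ τ * |1 - zonalCoeff ψ l| ^ 2
        ≤ (1 + eigenval l) ^ τ * (C * (ρ * √(1 + eigenval l)) ^ (σ - τ)) ^ 2 := by gcongr
      _ = _ := by
        rw [Real.mul_rpow hρ.le (Real.sqrt_nonneg _), ← h1]
        ring
  unfold sobolevTerm
  rw [Finset.mul_sum]
  refine Finset.sum_le_sum fun k _ => ?_
  have e1 : coeffDiv (fun x => f x - conv ψ f x) l k = (1 - zonalCoeff ψ l) * coeffDiv f l k :=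
    (isConvEigenfield_vecY hl k).integral_sub_conv hψ hn hf
  have e2 : coeffCurl (fun x => f x - conv ψ f x) l k = (1 - zonalCoeff ψ l) * coeffCurl f l k :=
    (isConvEigenfield_vecZ hl k).integral_sub_conv hψ hn hf
  rw [e1, e2, abs_mul, abs_mul]
  calc _ = ((1 + eigenval l) ^ τ * |1 - zonalCoeff ψ l| ^ 2) *
        (|coeffDiv f l k| ^ 2 + |coeffCurl f l k| ^ 2) := by ring
    _ ≤ ((C * ρ ^ (σ - τ)) ^ 2 * (1 + eigenval l) ^ σ) *
        (|coeffDiv f l k| ^ 2 + |coeffCurl f l k| ^ 2) := by gcongr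
    _ = _ := by ring

lemma sobolevNorm_le_of_term_le {τ σ D : ℝ} (hD : 0 ≤ D) {f g : S2 → E3}
    (h : ∀ n : ℕ, sobolevTerm τ g (n + 1) ≤ D ^ 2 * sobolevTerm σ f (n + 1)) :
    sobolevNorm τ g ≤ ENNReal.ofReal D * sobolevNorm σ f := by
  have hD' : ENNReal.ofReal D = ENNReal.ofReal (D ^ 2) ^ (1 / 2 : ℝ) := by
    rw [ENNReal.ofReal_rpow_of_nonneg (sq_nonneg D) (by norm_num), ← Real.sqrt_eq_rpow,
      Real.sqrt_sq hD]
  unfold sobolevNorm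
  rw [hD', ← ENNReal.mul_rpow_of_nonneg _ _ (by norm_num), ← ENNReal.tsum_mul_left]
  refine ENNReal.rpow_le_rpow (ENNReal.tsum_le_tsum fun n => ?_) (by norm_num)
  rw [← ENNReal.ofReal_mul (sq_nonneg D)]
  exact ENNReal.ofReal_le_ofReal (h n)

end TangentSphere

end

theorem mainTheorem3 (ψ : ℝ → ℝ → ℝ) (hψ : TangentSphere.IsZonalFamily ψ)
    (m σ τ : ℝ) (hm : TangentSphere.ApproxOrder ψ m) (hσm : σ ≤ m) (hτ : 0 ≤ τ) (hτσ : τ ≤ σ) :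
    ∃ C : ℝ, 0 < C ∧ ∀ ρ : ℝ, 0 < ρ → ρ < 1 →
      ∀ f : TangentSphere.S2 → TangentSphere.E3, TangentSphere.MemSobolev σ f →
        (∀ x : TangentSphere.S2,
          MeasureTheory.Integrable (TangentSphere.convIntegrand (ψ ρ) f x) TangentSphere.surf) ∧
        TangentSphere.MemSobolev τ (fun x => f x - TangentSphere.conv (ψ ρ) f x) ∧
        TangentSphere.sobolevNorm τ (fun x => f x - TangentSphere.conv (ψ ρ) f x) ≤
          ENNReal.ofReal (C * ρ ^ (σ - τ)) * TangentSphere.sobolevNorm σ f := by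
  open TangentSphere in
  -- The exponent is `s = σ - τ`, which is at most `m` because `τ ≥ 0`.
  obtain ⟨C, hC, hbound⟩ := exists_multiplier_bound hψ hm (sub_nonneg.2 hτσ) (by linarith)
  refine ⟨C, hC, fun ρ hρ hρ1 f hf => ?_⟩
  -- Continuity is given on `[-1, 1]` only; the constant extension is continuous on `ℝ` and has the
  -- same coefficients and the same operator.
  have hc : Continuous (iccExt (ψ ρ)) := continuous_iccExt (hψ.continuousOn_section ⟨hρ, hρ1⟩)
  have hcoeff : ∀ l, zonalCoeff (ψ ρ) l = zonalCoeff (iccExt (ψ ρ)) l :=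
    zonalCoeff_congr fun t ht => iccExt_eq (ψ ρ) ht
  have hn : zonalCoeff (iccExt (ψ ρ)) 0 = 1 := by rw [← hcoeff, hψ.normalised ρ ⟨hρ, hρ1⟩]
  rw [convIntegrand_iccExt, conv_iccExt]
  have hle : sobolevNorm τ (fun x => f x - conv (iccExt (ψ ρ)) f x) ≤
      ENNReal.ofReal (C * ρ ^ (σ - τ)) * sobolevNorm σ f :=
    sobolevNorm_le_of_term_le (by positivity) fun n =>
      sobolevTerm_sub_conv_le hc hn hf.1 hρ n.succ_ne_zero
        (by rw [← hcoeff]; exact hbound ρ hρ hρ1 (n + 1) (by omega))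
  have hconv := isTangentL2_conv hc hn hf.1.integrable
  refine ⟨integrable_convIntegrand hc hn hf.1.integrable, ⟨⟨fun x => ?_, hf.1.2.sub hconv.2⟩, ?_⟩,
    hle⟩
  · rw [inner_sub_right, hf.1.1 x, hconv.1 x, sub_zero]
  · exact hle.trans_lt (ENNReal.mul_lt_top ENNReal.ofReal_lt_top hf.2)
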